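/- Let $\mathbb K$ be $\mathbb R$ or $\mathbb C$, and write $X\oplus_2 Y$ and $(\oplus_n X_n)_2$ for $\ell_2$-direct sums of normed spaces, so $\|(x,y)\|^2=\|x\|^2+\|y\|^2$ and $\|(x_n)\|^2=\sum_n\|x_n\|^2$. Call $(x,y)$ an $\ell_p$-pair if $\|x+\lambda y\|^p=1+|\lambda|^p$ for every $\lambda\in\mathbb R$. For a Banach space $X$ and an ultrafilter $\mathcal U$ on a set $I$, the ultrapower $X_{\mathcal U}$ is the quotient of $\ell_\infty(I,X)$ by the families $(x_i)$ with $\lim_{i,\mathcal U}\|x_i\|=0$. Two Banach spaces are elementarily equivalent if some ultrapower of one is linearly isometric to some ultrapower of the other. An infinite dimensional Banach space $X$ is uncountably categorical if for some uncountable cardinal $\kappa$ there is, up to linear isometry, exactly one Banach space of density character $\kappa$ that is elementarily equivalent to $X$. Let $(E_n)_n$ and $(F_n)_n$ be sequences of finite dimensional normed spaces over $\mathbb K$, and let $1\le p_n<2$ and $2<q_n<\infty$ be exponents with $p_n\to 2$ and $q_n\to 2$, such that for every $n$: (a) $\|x+y\|^2+\|x-y\|^2\le 2(\|x\|^{p_n}+\|y\|^{p_n})^{2/p_n}$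 for all $x,y\in E_n$; (b) $E_n$ has a basis $\mathcal B$ such that for every $y\in\mathcal B$ there is $x\in\mathcal B$ such that $(x,y)$ is an $\ell_{p_n}$-pair; (a') $\|x+y\|^2+\|x-y\|^2\ge 2(\|x\|^{q_n}+\|y\|^{q_n})^{2/q_n}$ for all $x,y\in F_n$; (b') $F_n$ has a basis $\mathcal B$ such that for every $y\in\mathcal B$ there is $x\in\mathcal B$ such that $(x,y)$ is an $\ell_{q_n}$-pair. Assume moreover that there is a constant $C$ such that $\|x+y\|^2+\|x-y\|^2\le 2(\|x\|^2+\|Cy\|^2)$ for every $n$ and all $x,y\in F_n$. Put $E=(\oplus_n E_n)_2$ and $F=(\oplus_n F_n)_2$. Then for every Hilbert space $H$, every linear isometric embedding $T:E\oplus_2 F\to E\oplus_2 F\oplus_2 H$ maps $E$ onto $E$ and $F$ onto $F$. If infinitely many of the spaces $E_n$, $F_n$ are nonzero (in particular, if all of them are nonzero), then $X=E\oplus_2 F$ is an infinite dimensional Banach space with the following two properties: every ultrapower of $X$ is linearly isometric to $X\oplus_2 H$ for some Hilbert space $H$; and, for every Hilbert space $H$, every linear isometric embedding $X\to X\oplus_2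 H$ maps $X$ onto $X$. Moreover, $X$ is then uncountably categorical. -/

import Mathlib

open Filter Topology
open scoped ENNReal

universe u v

/-- The bounded families `(x i)` in `X` with `‖x i‖ → 0` along the ultrafilter `U`,
as a subspace of `ℓ_∞(I, X)`. -/
def ultraNull (𝕜 : Type*) [RCLike 𝕜] {I : Type*} (U : Ultrafilter I) (X : Type*)
    [NormedAddCommGroup X] [NormedSpace 𝕜 X] : Submodule 𝕜 (lp (fun _ : I => X) ∞) where
  carrier := {x | Tendsto (fun i => ‖x i‖) (U : Filter I) (𝓝 0)}
  zero_mem' := by simp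
  add_mem' := by
    intro x y hx hy
    have h := Tendsto.add hx hy
    rw [add_zero] at h
    exact squeeze_zero (fun i => norm_nonneg _) (fun i => norm_add_le (x i) (y i)) h
  smul_mem' := by
    intro c x hx
    have h := Tendsto.const_mul ‖c‖ hx
    rw [mul_zero] at h
    exact h.congr fun i => (norm_smul c (x i)).symm

/-- The ultrapower `X_U`: the quotient of `ℓ_∞(I, X)` by the families that are null along `U`,
with its quotient norm. -/
abbrev Ultrapower (𝕜 : Type*) [RCLike 𝕜] {I : Type*} (U : Ultrafilter I) (X : Type*)
    [NormedAddCommGroup X] [NormedSpace 𝕜 X] : Type _ :=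
  lp (fun _ : I => X) ∞ ⧸ ultraNull 𝕜 U X

/-- `X` and `Y` are elementarily equivalent: some ultrapower of `X` is linearly isometric to some
ultrapower of `Y`. -/
def ElementarilyEquivalent (𝕜 : Type*) [RCLike 𝕜] (X Y : Type u)
    [NormedAddCommGroup X] [NormedSpace 𝕜 X] [NormedAddCommGroup Y] [NormedSpace 𝕜 Y] : Prop :=
  ∃ (I J : Type u) (U : Ultrafilter I) (V : Ultrafilter J),
    Nonempty (Ultrapower 𝕜 U X ≃ₗᵢ[𝕜] Ultrapower 𝕜 V Y)

/-- The density character: the least cardinality of a dense subset. -/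
noncomputable def densityCharacter (X : Type u) [TopologicalSpace X] : Cardinal.{u} :=
  sInf {κ | ∃ s : Set X, Dense s ∧ Cardinal.mk s = κ}

/-- The elementary class of `X` has exactly one member of density character `κ`, up to linear
isometry. -/
def IsCategoricalIn (𝕜 : Type*) [RCLike 𝕜] (X : Type u)
    [NormedAddCommGroup X] [NormedSpace 𝕜 X] (κ : Cardinal.{u}) : Prop :=
  (∃ (Y : Type u) (_ : NormedAddCommGroup Y) (_ : NormedSpace 𝕜 Y) (_ : CompleteSpace Y),
    ElementarilyEquivalent 𝕜 X Y ∧ densityCharacter Y = κ) ∧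
  ∀ (Y Z : Type u) [NormedAddCommGroup Y] [NormedSpace 𝕜 Y] [CompleteSpace Y]
    [NormedAddCommGroup Z] [NormedSpace 𝕜 Z] [CompleteSpace Z],
    ElementarilyEquivalent 𝕜 X Y → densityCharacter Y = κ →
    ElementarilyEquivalent 𝕜 X Z → densityCharacter Z = κ →
    Nonempty (Y ≃ₗᵢ[𝕜] Z)

/-- An infinite dimensional Banach space is uncountably categorical if it is `κ`-categorical for
some uncountable cardinal `κ`. -/
def IsUncountablyCategorical (𝕜 : Type*) [RCLike 𝕜] (X : Type u)
    [NormedAddCommGroup X] [NormedSpace 𝕜 X] : Prop :=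
  CompleteSpace X ∧ ¬ FiniteDimensional 𝕜 X ∧
    ∃ κ : Cardinal.{u}, Cardinal.aleph0 < κ ∧ IsCategoricalIn 𝕜 X κ

/-- The 2-direct sum `X ⊕₂ Y`, with `‖(x, y)‖² = ‖x‖² + ‖y‖²`. -/
abbrev TwoSum (X Y : Type*) : Type _ := WithLp 2 (X × Y)

/-- The 2-direct sum `(⨁ E n)_{ℓ₂}` of a sequence of normed spaces, with `‖x‖² = ∑ ‖x n‖²`. -/
abbrev TwoSumSeq (E : ℕ → Type*) [∀ n, NormedAddCommGroup (E n)] : Type _ := lp E 2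

/-- The hypotheses of the criterion for uncountable categoricity, for a Banach space `X` with the
modular `Θ(x) = ‖x‖²`. For this modular the `Δ₂` condition holds since `Θ(2x) = 4 Θ(x)`, modular
direct sums are 2-direct sums, and linear isomodular maps are the linear isometric bijections. -/
structure CategoricityCriterion (𝕜 : Type*) [RCLike 𝕜] (X : Type u)
    [NormedAddCommGroup X] [NormedSpace 𝕜 X] : Prop where
  complete : CompleteSpace X
  infinite_dimensional : ¬ FiniteDimensional 𝕜 X
  /-- every ultrapower of `X` is linearly isometric to `X ⊕₂ H` for some Hilbert space `H` -/
  ultrapower : ∀ (I : Type u) (U : Ultrafilter I),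
    ∃ (H : Type u) (_ : NormedAddCommGroup H) (_ : InnerProductSpace 𝕜 H) (_ : CompleteSpace H),
      Nonempty (Ultrapower 𝕜 U X ≃ₗᵢ[𝕜] TwoSum X H)
  /-- every linear isometric embedding of `X` into `X ⊕₂ H` maps `X` onto `X` -/
  rigid : ∀ (H : Type u) [NormedAddCommGroup H] [InnerProductSpace 𝕜 H] [CompleteSpace H]
    (T : X →ₗᵢ[𝕜] TwoSum X H),
    Set.range T = Set.range fun x : X => (WithLp.toLp 2 (x, 0) : TwoSum X H)

/-- `(x, y)` is an `ℓ_p`-pair. -/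
def IsLpPair (𝕜 : Type*) [RCLike 𝕜] {X : Type*} [NormedAddCommGroup X] [NormedSpace 𝕜 X]
    (p : ℝ) (x y : X) : Prop :=
  ∀ t : ℝ, ‖x + (t : 𝕜) • y‖ ^ p = 1 + |t| ^ p

/-- The finite dimensional space `X` has a basis `b` such that for every `y` in `b` there is `x`
in `b` for which `(x, y)` is an `ℓ_p`-pair. -/
def HasLpPairBasis (𝕜 : Type*) [RCLike 𝕜] (X : Type*) [NormedAddCommGroup X] [NormedSpace 𝕜 X]
    (p : ℝ) : Prop :=
  ∃ (d : ℕ) (b : Module.Basis (Fin d) 𝕜 X), ∀ j, ∃ i, IsLpPair 𝕜 p (b i) (b j)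

/-! Categoricity rests on two facts about X = E ⊕₂ F: its ultrapowers only add a Hilbert space, and
X cannot move inside X ⊕₂ H.

Ultrapowers. A bounded family in X has a coordinatewise limit, because every coordinate space is
finite dimensional. What remains after subtracting it lives, along the ultrafilter, in arbitrarily
far tails, where the exponents are close to 2 and the parallelogram law almost holds. Hence the
remainders form a Hilbert space that is 2-orthogonal to X
(`AsymptoticallyHilbertian.exists_hilbert`).

Rigidity. For an ℓ_p-pair, ‖x+ty‖² + ‖x-ty‖² exceeds 2 by a quantity of order t^p as t → 0. If p <
2, then F, H and the coordinates of E with exponent above p only produce terms of higher order, so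
the image of y must have its mass on exponents at most p (`IsLpPair.one_le_sum`). If q > 2, then H
and every coordinate of F with exponent below q would produce a term that is too large, so y
vanishes there (`IsLpPair.eq_zero_of_lt`). The other exponents are excluded by induction, upwards in
E and downwards in F: their levels are already filled by images of vectors orthogonal to y. Since
exponents may repeat, the induction runs over whole levels, and finite dimension turns inclusion
into equality (`range_eq_of_level_step`).

Categoricity. If Y is elementarily equivalent to X, then Y embeds in some X ⊕₂ H, and rigidity
inside a further ultrapower forces this copy of Y to contain X, so Y = X ⊕₂ H'
(`CategoricityCriterion.exists_equiv`). As X is separable, an uncountable density character of Y is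
the Hilbert dimension of H', which determines Y. -/

noncomputable section

/-! ### Norms and functoriality of ultrapowers. -/

namespace Ultrapower

section Basic

variable {𝕜 : Type*} [RCLike 𝕜] {I : Type*} {U : Ultrafilter I} {X : Type*}
  [NormedAddCommGroup X] [NormedSpace 𝕜 X]

/-- The class of a bounded family. -/
def cls (𝕜 : Type*) [RCLike 𝕜] {I : Type*} (U : Ultrafilter I) {X : Type*}
    [NormedAddCommGroup X] [NormedSpace 𝕜 X] : lp (fun _ : I => X) ∞ →ₗ[𝕜] Ultrapower 𝕜 U X :=
  (ultraNull 𝕜 U X).mkQ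

lemma cls_apply (x : lp (fun _ : I => X) ∞) : cls 𝕜 U x = Submodule.Quotient.mk x := rfl

lemma cls_surjective : Function.Surjective (cls 𝕜 U (X := X)) :=
  (ultraNull 𝕜 U X).mkQ_surjective

lemma mem_ultraNull {x : lp (fun _ : I => X) ∞} :
    x ∈ ultraNull 𝕜 U X ↔ Tendsto (fun i => ‖x i‖) (U : Filter I) (𝓝 0) := Iff.rfl

/-- A bounded family as an element of `ℓ_∞(I, X)`. -/
def bdd (x : I → X) (h : ∃ C, ∀ i, ‖x i‖ ≤ C) : lp (fun _ : I => X) ∞ :=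
  ⟨x, memℓp_infty (by obtain ⟨C, hC⟩ := h; exact ⟨C, by rintro _ ⟨i, rfl⟩; exact hC i⟩)⟩

@[simp] lemma bdd_apply (x : I → X) (h : ∃ C, ∀ i, ‖x i‖ ≤ C) (i : I) : bdd x h i = x i := rfl

lemma norm_apply_le (x : lp (fun _ : I => X) ∞) (i : I) : ‖x i‖ ≤ ‖x‖ :=
  lp.norm_apply_le_norm (by simp) x i

/-- Bounded real functions converge along ultrafilters. -/
lemma exists_tendsto_of_bounded {K : Type*} [PseudoMetricSpace K] [ProperSpace K] {f : I → K}
    (hf : Bornology.IsBounded (Set.range f)) (U : Ultrafilter I) :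
    ∃ l, Tendsto f (U : Filter I) (𝓝 l) := by
  obtain ⟨l, -, hl⟩ := hf.isCompact_closure.ultrafilter_le_nhds (U.map f) (by
    rw [le_principal_iff, Ultrafilter.mem_coe, Ultrafilter.mem_map]
    exact Filter.mem_of_superset Filter.univ_mem fun i _ => subset_closure (Set.mem_range_self i))
  exact ⟨l, hl⟩

/-- Replacing the terms that violate the bound by 0 does not change the class. -/
lemma norm_cls_le_of_eventually {x : lp (fun _ : I => X) ∞} {c : ℝ} (hc : 0 ≤ c)
    (h : ∀ᶠ i in (U : Filter I), ‖x i‖ ≤ c) : ‖cls 𝕜 U x‖ ≤ c := by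
  classical
  let y : lp (fun _ : I => X) ∞ := bdd (fun i => if ‖x i‖ ≤ c then x i else 0)
    ⟨c, fun i => by split_ifs with hi <;> simp [hi, hc]⟩
  have hxy : cls 𝕜 U x = cls 𝕜 U y := by
    rw [← sub_eq_zero, ← map_sub]
    refine (Submodule.Quotient.mk_eq_zero _).2 ?_
    rw [mem_ultraNull]
    refine tendsto_const_nhds.congr' ?_
    filter_upwards [h] with i hi
    simp [y, hi]
  rw [hxy]
  refine (Submodule.Quotient.norm_mk_le (ultraNull 𝕜 U X) y).trans ?_
  refine lp.norm_le_of_forall_le hc fun i => ?_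
  simp only [y, bdd_apply]
  split_ifs with hi <;> simp [hi, hc]

lemma tendsto_norm_cls (x : lp (fun _ : I => X) ∞) :
    Tendsto (fun i => ‖x i‖) (U : Filter I) (𝓝 ‖cls 𝕜 U x‖) := by
  obtain ⟨l, hl⟩ := exists_tendsto_of_bounded (f := fun i => ‖x i‖)
    ((Metric.isBounded_Icc 0 ‖x‖).subset (by
      rintro _ ⟨i, rfl⟩; exact ⟨norm_nonneg _, norm_apply_le x i⟩)) U
  have hl0 : 0 ≤ l := ge_of_tendsto' hl fun i => norm_nonneg _
  have h1 : ‖cls 𝕜 U x‖ ≤ l := by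
    refine le_of_forall_gt_imp_ge_of_dense fun c hc => ?_
    exact norm_cls_le_of_eventually (hl0.trans hc.le)
      ((hl.eventually_lt_const hc).mono fun i hi => hi.le)
  -- A representative whose norm is within `ε` of the quotient norm differs from `x` by a null
  -- family, so it has the same limit of norms.
  have h2 : l ≤ ‖cls 𝕜 U x‖ := by
    refine le_of_forall_pos_le_add fun ε hε => ?_
    obtain ⟨m, hm, hmε⟩ := Submodule.Quotient.norm_mk_lt (S := ultraNull 𝕜 U X) (cls 𝕜 U x) hε
    rw [cls_apply] at hm
    have hn : x - m ∈ ultraNull 𝕜 U X := (Submodule.Quotient.eq (ultraNull 𝕜 U X)).1 hm.symm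
    have hn' := (mem_ultraNull.1 hn).add_const (‖cls 𝕜 U x‖ + ε)
    rw [zero_add] at hn'
    refine le_of_tendsto_of_tendsto' hl hn' fun i => ?_
    have h3 : x i = (x - m) i + m i := by simp
    calc ‖x i‖ ≤ ‖(x - m) i‖ + ‖m i‖ := by conv_lhs => rw [h3]
                                           exact norm_add_le _ _
      _ ≤ _ := by gcongr; exact (norm_apply_le m i).trans hmε.le
  rwa [le_antisymm h1 h2]

lemma norm_cls_eq {x : lp (fun _ : I => X) ∞} {c : ℝ}
    (h : Tendsto (fun i => ‖x i‖) (U : Filter I) (𝓝 c)) : ‖cls 𝕜 U x‖ = c :=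
  tendsto_nhds_unique (tendsto_norm_cls x) h

lemma cls_eq_zero {x : lp (fun _ : I => X) ∞} :
    cls 𝕜 U x = 0 ↔ Tendsto (fun i => ‖x i‖) (U : Filter I) (𝓝 0) :=
  Submodule.Quotient.mk_eq_zero _

/-- Closedness is what turns the quotient seminorm of the ultrapower into a norm. -/
instance isClosed_ultraNull : IsClosed (ultraNull 𝕜 U X : Set (lp (fun _ : I => X) ∞)) := by
  have h : (ultraNull 𝕜 U X : Set (lp (fun _ : I => X) ∞)) = {x | ‖(cls 𝕜 U x : Ultrapower 𝕜 U X)‖ = 0} := by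
    ext x
    refine ⟨fun hx => norm_cls_eq hx, fun hx => ?_⟩
    have := tendsto_norm_cls (𝕜 := 𝕜) (U := U) x
    rw [Set.mem_ofPred_eq] at hx
    rwa [hx] at this
  rw [h]
  refine isClosed_eq ?_ continuous_const
  refine continuous_norm.comp (AddMonoidHomClass.continuous_of_bound
    (cls 𝕜 U (X := X)) 1 fun x => ?_)
  rw [one_mul]
  exact Submodule.Quotient.norm_mk_le (ultraNull 𝕜 U X) x

/-- A linear map on `ℓ_∞(I, X)` whose values have the limit norms descends to the ultrapower. -/
def lift {M : Type*} [NormedAddCommGroup M] [NormedSpace 𝕜 M] (R : lp (fun _ : I => X) ∞ →ₗ[𝕜] M)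
    (hR : ∀ x, Tendsto (fun i => ‖x i‖) (U : Filter I) (𝓝 ‖R x‖)) : Ultrapower 𝕜 U X →ₗᵢ[𝕜] M where
  toLinearMap := (ultraNull 𝕜 U X).liftQ R fun x hx => by
    rw [LinearMap.mem_ker, ← norm_eq_zero]
    exact tendsto_nhds_unique (hR x) hx
  norm_map' v := by
    obtain ⟨x, rfl⟩ := cls_surjective v
    exact (norm_cls_eq (hR x)).symm

@[simp] lemma lift_cls {M : Type*} [NormedAddCommGroup M] [NormedSpace 𝕜 M]
    (R : lp (fun _ : I => X) ∞ →ₗ[𝕜] M)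
    (hR : ∀ x, Tendsto (fun i => ‖x i‖) (U : Filter I) (𝓝 ‖R x‖)) (x : lp (fun _ : I => X) ∞) :
    lift R hR (cls 𝕜 U x) = R x := rfl

/-- The diagonal embedding. -/
def diag (𝕜 : Type*) [RCLike 𝕜] {I : Type*} (U : Ultrafilter I) {X : Type*}
    [NormedAddCommGroup X] [NormedSpace 𝕜 X] : X →ₗᵢ[𝕜] Ultrapower 𝕜 U X where
  toLinearMap := cls 𝕜 U ∘ₗ
    { toFun := fun x => bdd (fun _ => x) ⟨‖x‖, fun _ => le_rfl⟩
      map_add' := fun _ _ => rfl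
      map_smul' := fun _ _ => rfl }
  norm_map' _ := norm_cls_eq tendsto_const_nhds

lemma diag_apply (x : X) : diag 𝕜 U x = cls 𝕜 U (bdd (fun _ => x) ⟨‖x‖, fun _ => le_rfl⟩) := rfl

variable {Y : Type*} [NormedAddCommGroup Y] [NormedSpace 𝕜 Y]

/-- Coordinatewise application of a bounded linear map. -/
def lpMap (f : X →L[𝕜] Y) : lp (fun _ : I => X) ∞ →ₗ[𝕜] lp (fun _ : I => Y) ∞ where
  toFun x := bdd (fun i => f (x i)) ⟨‖f‖ * ‖x‖, fun i => (f.le_opNorm _).trans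
    (mul_le_mul_of_nonneg_left (norm_apply_le x i) (norm_nonneg _))⟩
  map_add' x y := by ext i; simp
  map_smul' c x := by ext i; simp

@[simp] lemma lpMap_apply (f : X →L[𝕜] Y) (x : lp (fun _ : I => X) ∞) (i : I) :
    lpMap f x i = f (x i) := rfl

/-- The ultrapower of a linear isometry. -/
def map (U : Ultrafilter I) (f : X →ₗᵢ[𝕜] Y) : Ultrapower 𝕜 U X →ₗᵢ[𝕜] Ultrapower 𝕜 U Y :=
  lift (cls 𝕜 U ∘ₗ lpMap f.toContinuousLinearMap) fun x => by
    simpa using tendsto_norm_cls (𝕜 := 𝕜) (U := U) (lpMap f.toContinuousLinearMap x)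

lemma map_cls (f : X →ₗᵢ[𝕜] Y) (x : lp (fun _ : I => X) ∞) :
    map U f (cls 𝕜 U x) = cls 𝕜 U (lpMap f.toContinuousLinearMap x) := rfl

/-- The ultrapower of a 2-sum embeds into the 2-sum of the ultrapowers. -/
def prodMap (𝕜 : Type*) [RCLike 𝕜] {I : Type*} (U : Ultrafilter I) (X Y : Type*)
    [NormedAddCommGroup X] [NormedSpace 𝕜 X] [NormedAddCommGroup Y] [NormedSpace 𝕜 Y] :
    Ultrapower 𝕜 U (TwoSum X Y) →ₗᵢ[𝕜] TwoSum (Ultrapower 𝕜 U X) (Ultrapower 𝕜 U Y) :=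
  lift ((WithLp.linearEquiv 2 𝕜 _).symm.toLinearMap ∘ₗ
    (cls 𝕜 U ∘ₗ lpMap (WithLp.fstL 2 𝕜 X Y)).prod (cls 𝕜 U ∘ₗ lpMap (WithLp.sndL 2 𝕜 X Y)))
    fun x => by
      have h1 := tendsto_norm_cls (𝕜 := 𝕜) (U := U) (lpMap (WithLp.fstL 2 𝕜 X Y) x)
      have h2 := tendsto_norm_cls (𝕜 := 𝕜) (U := U) (lpMap (WithLp.sndL 2 𝕜 X Y) x)
      rw [WithLp.prod_norm_eq_of_L2]
      refine ((h1.pow 2).add (h2.pow 2)).sqrt.congr fun i => ?_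
      rw [WithLp.prod_norm_eq_of_L2 (x i)]
      rfl

/-- Ultrapowers of Hilbert spaces satisfy the parallelogram law. -/
lemma parallelogram {H : Type*} [NormedAddCommGroup H] [InnerProductSpace 𝕜 H]
    (v w : Ultrapower 𝕜 U H) :
    ‖v + w‖ * ‖v + w‖ + ‖v - w‖ * ‖v - w‖ = 2 * (‖v‖ * ‖v‖ + ‖w‖ * ‖w‖) := by
  obtain ⟨x, rfl⟩ := cls_surjective v
  obtain ⟨y, rfl⟩ := cls_surjective w
  rw [← map_add, ← map_sub]
  have h1 := tendsto_norm_cls (𝕜 := 𝕜) (U := U) (x + y)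
  have h2 := tendsto_norm_cls (𝕜 := 𝕜) (U := U) (x - y)
  have h3 := tendsto_norm_cls (𝕜 := 𝕜) (U := U) x
  have h4 := tendsto_norm_cls (𝕜 := 𝕜) (U := U) y
  refine tendsto_nhds_unique ((h1.mul h1).add (h2.mul h2))
    ((((h3.mul h3).add (h4.mul h4)).const_mul 2).congr fun i => ?_)
  have h := parallelogram_law_with_norm 𝕜 (x i) (y i)
  simp only [pow_two] at h
  exact h.symm

/-- The inner product of the ultrapower of a Hilbert space. -/
@[reducible] def innerProductSpace {H : Type*} [NormedAddCommGroup H]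
    [InnerProductSpace 𝕜 H] : InnerProductSpace 𝕜 (Ultrapower 𝕜 U H) :=
  InnerProductSpace.ofNorm 𝕜 parallelogram

lemma cls_eq_diag_iff {x : lp (fun _ : I => X) ∞} {a : X} :
    cls 𝕜 U x = diag 𝕜 U a ↔ Tendsto (fun i => x i) (U : Filter I) (𝓝 a) := by
  rw [← sub_eq_zero, diag_apply, ← map_sub, cls_eq_zero,
    tendsto_iff_norm_sub_tendsto_zero (f := fun i => x i)]
  rfl

end Basic

end Ultrapower

end

/-! ### Splitting a Hilbert space off an ultrapower. -/

noncomputable section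

lemma norm_two_smul_sq {𝕜 : Type*} [RCLike 𝕜] {V : Type*} [NormedAddCommGroup V] [NormedSpace 𝕜 V] (v : V) :
    ‖v + v‖ ^ 2 = 4 * ‖v‖ ^ 2 := by
  rw [← two_smul 𝕜 v, norm_smul, mul_pow]
  norm_num

/-- A norm satisfying the parallelogram inequality in one direction satisfies the law. -/
lemma parallelogram_of_le {V : Type*} [NormedAddCommGroup V] {𝕜 : Type*} [RCLike 𝕜]
    [NormedSpace 𝕜 V] (S : Submodule 𝕜 V)
    (h : ∀ x ∈ S, ∀ y ∈ S, ‖x + y‖ ^ 2 + ‖x - y‖ ^ 2 ≤ 2 * (‖x‖ ^ 2 + ‖y‖ ^ 2)) (x y : S) :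
    ‖x + y‖ * ‖x + y‖ + ‖x - y‖ * ‖x - y‖ = 2 * (‖x‖ * ‖x‖ + ‖y‖ * ‖y‖) := by
  have h1 := h x x.2 y y.2
  -- The substitution (x + y, x - y) is an involution up to the factor 2, so it yields the reverse
  -- inequality.
  have h2 := h (x + y) (S.add_mem x.2 y.2) (x - y) (S.sub_mem x.2 y.2)
  rw [show (x : V) + y + (x - y) = x + x by abel, show (x : V) + y - (x - y) = y + y by abel,
    norm_two_smul_sq (𝕜 := 𝕜), norm_two_smul_sq (𝕜 := 𝕜)] at h2
  simp only [← pow_two, Submodule.coe_norm, Submodule.coe_add, Submodule.coe_sub]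
  linarith

/-- A norm-orthogonal retraction with Hilbertian kernel splits off a Hilbert space. -/
theorem exists_equiv_twoSum_hilbert {𝕜 : Type*} [RCLike 𝕜] {X : Type*} {V : Type u}
    [NormedAddCommGroup X] [NormedSpace 𝕜 X] [NormedAddCommGroup V] [NormedSpace 𝕜 V]
    [CompleteSpace V] (D : X →ₗᵢ[𝕜] V) (L : V →ₗ[𝕜] X) (hLD : ∀ x, L (D x) = x)
    (hsq : ∀ v, ‖v‖ ^ 2 = ‖L v‖ ^ 2 + ‖v - D (L v)‖ ^ 2)
    (hpar : ∀ v w, L v = 0 → L w = 0 → ‖v + w‖ ^ 2 + ‖v - w‖ ^ 2 ≤ 2 * (‖v‖ ^ 2 + ‖w‖ ^ 2)) :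
    ∃ (H : Type u) (_ : NormedAddCommGroup H) (_ : InnerProductSpace 𝕜 H) (_ : CompleteSpace H),
      Nonempty (V ≃ₗᵢ[𝕜] TwoSum X H) := by
  let K : Submodule 𝕜 V := LinearMap.ker L
  have hLc : Continuous L := AddMonoidHomClass.continuous_of_bound L 1 fun v => by
    rw [one_mul]
    have := hsq v
    exact abs_le_of_sq_le_sq' (by nlinarith [sq_nonneg ‖v - D (L v)‖]) (norm_nonneg _) |>.2
  have hK : IsClosed (K : Set V) := isClosed_singleton.preimage hLc
  have hKc : CompleteSpace K := hK.completeSpace_coe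
  let ip : InnerProductSpace 𝕜 K := InnerProductSpace.ofNorm 𝕜
    (parallelogram_of_le K fun x hx y hy => hpar x y hx hy)
  let R : V →ₗ[𝕜] K :=
    (LinearMap.id - D.toLinearMap ∘ₗ L).codRestrict K fun v => by
      have h : L (v - D (L v)) = 0 := by rw [map_sub, hLD, sub_self]
      exact h
  have hR : ∀ v, (R v : V) = v - D (L v) := fun v => rfl
  let Φ : V →ₗᵢ[𝕜] TwoSum X K :=
    { toLinearMap := (WithLp.linearEquiv 2 𝕜 (X × K)).symm.toLinearMap ∘ₗ L.prod R
      norm_map' := fun v => by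
        have h1 := hsq v
        have h2 := WithLp.prod_norm_sq_eq_of_L2 (WithLp.toLp 2 (L v, R v) : TwoSum X K)
        refine (sq_eq_sq₀ (norm_nonneg _) (norm_nonneg _)).1 ?_
        rw [h1]
        exact h2 }
  have hΦ : Function.Surjective Φ := by
    intro y
    refine ⟨D y.fst + y.snd, ?_⟩
    have h0 : L (y.snd : V) = 0 := y.snd.2
    have h1 : L (D y.fst + y.snd) = y.fst := by
      rw [map_add, hLD, h0, add_zero]
    have h2 : R (D y.fst + y.snd) = y.snd := by
      apply Subtype.ext
      rw [hR, h1, add_sub_cancel_left]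
    change WithLp.toLp 2 (L _, R _) = y
    rw [h1, h2]
    rfl
  exact ⟨K, inferInstance, ip, hKc, ⟨LinearIsometryEquiv.ofSurjective Φ hΦ⟩⟩

/-- A space with orthogonal truncations `P N`, coordinatewise weakly compact, whose tails are
asymptotically Hilbertian. -/
structure AsymptoticallyHilbertian {𝕜 : Type*} [RCLike 𝕜] {X : Type u} [NormedAddCommGroup X]
    [NormedSpace 𝕜 X] (P : ℕ → X →ₗ[𝕜] X) : Prop where
  exists_limit : ∀ {I : Type u} (U : Ultrafilter I) (x : I → X) (C : ℝ), (∀ i, ‖x i‖ ≤ C) →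
    ∃ l, ∀ N, Tendsto (fun i => P N (x i)) (U : Filter I) (𝓝 (P N l))
  norm_sq : ∀ N x, ‖x‖ ^ 2 = ‖P N x‖ ^ 2 + ‖x - P N x‖ ^ 2
  tendsto : ∀ x, Tendsto (fun N => P N x) atTop (𝓝 x)
  parallelogram_le : ∀ ε : ℝ, 0 < ε → ∃ N, ∀ x y,
    ‖(x - P N x) + (y - P N y)‖ ^ 2 + ‖(x - P N x) - (y - P N y)‖ ^ 2 ≤
      2 * (1 + ε) * (‖x - P N x‖ ^ 2 + ‖y - P N y‖ ^ 2)

namespace AsymptoticallyHilbertian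

open Ultrapower

variable {𝕜 : Type*} [RCLike 𝕜] {X : Type u} [NormedAddCommGroup X] [NormedSpace 𝕜 X]
  {P : ℕ → X →ₗ[𝕜] X}

lemma norm_tail_le (hP : AsymptoticallyHilbertian P) (N : ℕ) (x : X) : ‖x - P N x‖ ≤ ‖x‖ := by
  have := hP.norm_sq N x
  exact abs_le_of_sq_le_sq' (by nlinarith [sq_nonneg ‖P N x‖]) (norm_nonneg _) |>.2

lemma ext_limit (hP : AsymptoticallyHilbertian P) {l m : X} (h : ∀ N, P N l = P N m) : l = m :=
  tendsto_nhds_unique ((hP.tendsto l).congr h) (hP.tendsto m)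

variable {I : Type u} (U : Ultrafilter I)

/-- The coordinatewise limit of a bounded family. -/
def limit (hP : AsymptoticallyHilbertian P) : lp (fun _ : I => X) ∞ →ₗ[𝕜] X where
  toFun x := (hP.exists_limit U x ‖x‖ (norm_apply_le x)).choose
  map_add' x y := by
    refine hP.ext_limit fun N => tendsto_nhds_unique
      ((hP.exists_limit U (x + y) ‖x + y‖ (norm_apply_le (x + y))).choose_spec N) ?_
    rw [map_add]
    refine (((hP.exists_limit U x ‖x‖ (norm_apply_le x)).choose_spec N).add
      ((hP.exists_limit U y ‖y‖ (norm_apply_le y)).choose_spec N)).congr fun i => ?_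
    rw [← map_add]; rfl
  map_smul' c x := by
    refine hP.ext_limit fun N => tendsto_nhds_unique
      ((hP.exists_limit U (c • x) ‖c • x‖ (norm_apply_le (c • x))).choose_spec N) ?_
    rw [RingHom.id_apply, map_smul]
    refine (((hP.exists_limit U x ‖x‖ (norm_apply_le x)).choose_spec N).const_smul c).congr
      fun i => ?_
    rw [← map_smul]; rfl

lemma tendsto_limit (hP : AsymptoticallyHilbertian P) (x : lp (fun _ : I => X) ∞) (N : ℕ) :
    Tendsto (fun i => P N (x i)) (U : Filter I) (𝓝 (P N (hP.limit U x))) :=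
  (hP.exists_limit U x ‖x‖ (norm_apply_le x)).choose_spec N

lemma limit_eq (hP : AsymptoticallyHilbertian P) {x : lp (fun _ : I => X) ∞} {l : X}
    (h : ∀ N, Tendsto (fun i => P N (x i)) (U : Filter I) (𝓝 (P N l))) : hP.limit U x = l :=
  hP.ext_limit fun N => tendsto_nhds_unique (hP.tendsto_limit U x N) (h N)

/-- Write x_i = l + z_i with l the limit. The head `P N (z i)` tends to 0, so the heads account for
‖P_N l‖², while in the tails l only matters through l - P_N l. The error is thus a multiple of ‖l -
P_N l‖, which vanishes as N → ∞. -/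
lemma norm_sq_cls (hP : AsymptoticallyHilbertian P) (x : lp (fun _ : I => X) ∞) :
    ‖cls 𝕜 U x‖ ^ 2 = ‖hP.limit U x‖ ^ 2 + ‖cls 𝕜 U x - diag 𝕜 U (hP.limit U x)‖ ^ 2 := by
  set l := hP.limit U x with hl
  set z : lp (fun _ : I => X) ∞ := x - bdd (fun _ => l) ⟨‖l‖, fun _ => le_rfl⟩ with hz
  have hzi : ∀ i, x i = l + z i := fun i => by simp [hz]
  have hmz : cls 𝕜 U x - diag 𝕜 U l = cls 𝕜 U z := by rw [diag_apply, hz, map_sub]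
  rw [hmz]
  have hPz : ∀ N, Tendsto (fun i => P N (z i)) (U : Filter I) (𝓝 0) := fun N => by
    have h := (hP.tendsto_limit U x N).sub_const (P N l)
    rw [← hl, sub_self] at h
    refine h.congr fun i => ?_
    rw [hzi i, map_add, add_sub_cancel_left]
  have hD : Tendsto (fun i => ‖x i‖ ^ 2 - ‖z i‖ ^ 2) (U : Filter I)
      (𝓝 (‖cls 𝕜 U x‖ ^ 2 - ‖cls 𝕜 U z‖ ^ 2)) :=
    ((tendsto_norm_cls x).pow 2).sub ((tendsto_norm_cls z).pow 2)
  have hN : ∀ N, |‖cls 𝕜 U x‖ ^ 2 - ‖cls 𝕜 U z‖ ^ 2 - ‖P N l‖ ^ 2| ≤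
      ‖l - P N l‖ * (‖l‖ + 2 * ‖z‖) := by
    intro N
    have h1 : Tendsto (fun i => ‖P N l + P N (z i)‖ ^ 2 - ‖P N (z i)‖ ^ 2) (U : Filter I)
        (𝓝 (‖P N l‖ ^ 2)) := by
      have := (((hPz N).const_add (P N l)).norm.pow 2).sub ((hPz N).norm.pow 2)
      simpa using this
    refine le_of_tendsto' ((hD.sub h1).abs) fun i => ?_
    have e1 := hP.norm_sq N (x i)
    have e2 := hP.norm_sq N (z i)
    have e3 : x i - P N (x i) = (l - P N l) + (z i - P N (z i)) := by
      rw [hzi i, map_add]; abel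
    have e4 : P N (x i) = P N l + P N (z i) := by rw [hzi i, map_add]
    rw [e3, e4] at e1
    have b1 := hP.norm_tail_le N l
    have b2 := (hP.norm_tail_le N (z i)).trans (norm_apply_le z i)
    have t1 := norm_add_le (l - P N l) (z i - P N (z i))
    have t2 : ‖z i - P N (z i)‖ ≤ ‖(l - P N l) + (z i - P N (z i))‖ + ‖l - P N l‖ := by
      have := norm_sub_le ((l - P N l) + (z i - P N (z i))) (l - P N l)
      rwa [add_sub_cancel_left] at this
    have hr : ‖x i‖ ^ 2 - ‖z i‖ ^ 2 - (‖P N l + P N (z i)‖ ^ 2 - ‖P N (z i)‖ ^ 2) =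
      ‖(l - P N l) + (z i - P N (z i))‖ ^ 2 - ‖z i - P N (z i)‖ ^ 2 := by linarith
    rw [hr]
    generalize ‖(l - P N l) + (z i - P N (z i))‖ = c at *
    generalize hb : ‖z i - P N (z i)‖ = b at *
    have hb0 : 0 ≤ b := hb ▸ norm_nonneg _
    generalize ha : ‖l - P N l‖ = a at *
    have ha0 : 0 ≤ a := ha ▸ norm_nonneg _
    have hc : |c - b| ≤ a := abs_le.2 ⟨by linarith, by linarith⟩
    -- Here `c` stands for a norm whose sign was forgotten in the generalization; the estimate holds
    -- for either sign.
    by_cases hc0 : 0 ≤ c + b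
    · rw [show c ^ 2 - b ^ 2 = (c - b) * (c + b) by ring, abs_mul, abs_of_nonneg hc0]
      exact mul_le_mul hc (by linarith) hc0 ha0
    · rw [show c ^ 2 - b ^ 2 = (c - b) * (c + b) by ring, abs_mul, abs_of_neg (not_le.1 hc0)]
      exact mul_le_mul hc (by linarith) (by linarith) ha0
  have hlim : Tendsto (fun N => |‖cls 𝕜 U x‖ ^ 2 - ‖cls 𝕜 U z‖ ^ 2 - ‖P N l‖ ^ 2|) atTop
      (𝓝 |‖cls 𝕜 U x‖ ^ 2 - ‖cls 𝕜 U z‖ ^ 2 - ‖l‖ ^ 2|) :=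
    (tendsto_const_nhds.sub ((hP.tendsto l).norm.pow 2)).abs
  have hlim' : Tendsto (fun N => ‖l - P N l‖ * (‖l‖ + 2 * ‖z‖)) atTop (𝓝 0) := by
    have := ((tendsto_const_nhds (x := l)).sub (hP.tendsto l)).norm.mul_const (‖l‖ + 2 * ‖z‖)
    simpa using this
  have := abs_nonpos_iff.1 (le_of_tendsto_of_tendsto' hlim hlim' hN)
  linarith

/-- The coordinatewise limit on the ultrapower. -/
def limitMap (hP : AsymptoticallyHilbertian P) : Ultrapower 𝕜 U X →ₗ[𝕜] X :=
  (ultraNull 𝕜 U X).liftQ (hP.limit U) fun x hx => by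
    -- The norm identity forces the limit of a null family to be 0.
    have h := hP.norm_sq_cls U x
    rw [cls_eq_zero.2 hx, norm_zero] at h
    rw [LinearMap.mem_ker, ← norm_eq_zero]
    nlinarith [sq_nonneg ‖hP.limit U x‖, sq_nonneg ‖0 - diag 𝕜 U (hP.limit U x)‖]

lemma limitMap_cls (hP : AsymptoticallyHilbertian P) (x : lp (fun _ : I => X) ∞) :
    hP.limitMap U (cls 𝕜 U x) = hP.limit U x := rfl

lemma limitMap_diag (hP : AsymptoticallyHilbertian P) (x : X) :
    hP.limitMap U (diag 𝕜 U x) = x :=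
  hP.limit_eq U fun _ => tendsto_const_nhds

lemma norm_sq_eq (hP : AsymptoticallyHilbertian P) (v : Ultrapower 𝕜 U X) :
    ‖v‖ ^ 2 = ‖hP.limitMap U v‖ ^ 2 + ‖v - diag 𝕜 U (hP.limitMap U v)‖ ^ 2 := by
  obtain ⟨x, rfl⟩ := cls_surjective v
  exact hP.norm_sq_cls U x

/-- When the limit is 0, the heads tend to 0 for every fixed N and only the tails count. These
satisfy the inequality up to the factor 1 + ε, with ε arbitrary. -/
lemma parallelogram_ker (hP : AsymptoticallyHilbertian P) (v w : Ultrapower 𝕜 U X)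
    (hv : hP.limitMap U v = 0) (hw : hP.limitMap U w = 0) :
    ‖v + w‖ ^ 2 + ‖v - w‖ ^ 2 ≤ 2 * (‖v‖ ^ 2 + ‖w‖ ^ 2) := by
  obtain ⟨x, rfl⟩ := cls_surjective v
  obtain ⟨y, rfl⟩ := cls_surjective w
  have key : ∀ ε : ℝ, 0 < ε → ‖cls 𝕜 U x + cls 𝕜 U y‖ ^ 2 + ‖cls 𝕜 U x - cls 𝕜 U y‖ ^ 2 ≤
      2 * (1 + ε) * (‖cls 𝕜 U x‖ ^ 2 + ‖cls 𝕜 U y‖ ^ 2) := by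
    intro ε hε
    obtain ⟨N, hN⟩ := hP.parallelogram_le ε hε
    have hx := hP.tendsto_limit U x N
    have hy := hP.tendsto_limit U y N
    rw [← limitMap_cls, hv, map_zero] at hx
    rw [← limitMap_cls, hw, map_zero] at hy
    have h0 : Tendsto (fun i => ‖P N (x i) + P N (y i)‖ ^ 2 + ‖P N (x i) - P N (y i)‖ ^ 2)
        (U : Filter I) (𝓝 0) := by
      simpa using ((hx.add hy).norm.pow 2).add ((hx.sub hy).norm.pow 2)
    have hr := h0.add ((((tendsto_norm_cls (𝕜 := 𝕜) (U := U) x).pow 2).add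
      ((tendsto_norm_cls (𝕜 := 𝕜) (U := U) y).pow 2)).const_mul (2 * (1 + ε)))
    rw [zero_add] at hr
    rw [← map_add, ← map_sub]
    refine le_of_tendsto_of_tendsto' (((tendsto_norm_cls (𝕜 := 𝕜) (U := U) (x + y)).pow 2).add
      ((tendsto_norm_cls (𝕜 := 𝕜) (U := U) (x - y)).pow 2)) hr fun i => ?_
    have e1 := hP.norm_sq N (x i + y i)
    have e2 := hP.norm_sq N (x i - y i)
    rw [map_add, show x i + y i - (P N (x i) + P N (y i)) =
      (x i - P N (x i)) + (y i - P N (y i)) by abel] at e1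
    rw [map_sub, show x i - y i - (P N (x i) - P N (y i)) =
      (x i - P N (x i)) - (y i - P N (y i)) by abel] at e2
    have e3 := hN (x i) (y i)
    have b1 := pow_le_pow_left₀ (norm_nonneg _) (hP.norm_tail_le N (x i)) 2
    have b2 := pow_le_pow_left₀ (norm_nonneg _) (hP.norm_tail_le N (y i)) 2
    have b3 := mul_le_mul_of_nonneg_left (add_le_add b1 b2) (by positivity : 0 ≤ 2 * (1 + ε))
    change ‖x i + y i‖ ^ 2 + ‖x i - y i‖ ^ 2 ≤ _
    linarith
  have hlim : Tendsto (fun ε : ℝ => 2 * (1 + ε) * (‖cls 𝕜 U x‖ ^ 2 + ‖cls 𝕜 U y‖ ^ 2)) (𝓝[>] 0)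
      (𝓝 (2 * (1 + 0) * (‖cls 𝕜 U x‖ ^ 2 + ‖cls 𝕜 U y‖ ^ 2))) :=
    (Continuous.tendsto (by fun_prop) 0).mono_left nhdsWithin_le_nhds
  have := ge_of_tendsto hlim (eventually_nhdsWithin_of_forall key)
  simpa using this

/-- The ultrapower is the 2-sum of the space with the Hilbert space of null families. -/
theorem exists_hilbert (hP : AsymptoticallyHilbertian P) [CompleteSpace X] :
    ∃ (H : Type u) (_ : NormedAddCommGroup H) (_ : InnerProductSpace 𝕜 H) (_ : CompleteSpace H),
      Nonempty (Ultrapower 𝕜 U X ≃ₗᵢ[𝕜] TwoSum X H) :=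
  exists_equiv_twoSum_hilbert (diag 𝕜 U) (hP.limitMap U) (hP.limitMap_diag U) (hP.norm_sq_eq U)
    (hP.parallelogram_ker U)

end AsymptoticallyHilbertian

end

/-! ### The elementary class of a rigid space. -/

noncomputable section

open Cardinal

/-- The first summand of a 2-sum. -/
def twoSumInl (𝕜 : Type*) [RCLike 𝕜] (X H : Type*) [NormedAddCommGroup X] [NormedSpace 𝕜 X]
    [NormedAddCommGroup H] [NormedSpace 𝕜 H] : X →ₗᵢ[𝕜] TwoSum X H where
  toLinearMap := (WithLp.linearEquiv 2 𝕜 (X × H)).symm.toLinearMap ∘ₗ LinearMap.inl 𝕜 X H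
  norm_map' x := WithLp.norm_toLp_fst 2 X H x

section Structure

variable {𝕜 : Type*} [RCLike 𝕜] {X : Type u} [NormedAddCommGroup X] [NormedSpace 𝕜 X]

open Ultrapower

/-- A complete subspace of `X ⊕₂ H` that contains `X` is `X ⊕₂ H'` for a Hilbert space `H'`. -/
theorem exists_equiv_of_inl_mem_range {X H : Type*} {Y : Type u} [NormedAddCommGroup X]
    [NormedSpace 𝕜 X] [NormedAddCommGroup H] [InnerProductSpace 𝕜 H] [NormedAddCommGroup Y]
    [NormedSpace 𝕜 Y] [CompleteSpace Y] (J : Y →ₗᵢ[𝕜] TwoSum X H)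
    (hJ : ∀ x : X, twoSumInl 𝕜 X H x ∈ Set.range J) :
    ∃ (H : Type u) (_ : NormedAddCommGroup H) (_ : InnerProductSpace 𝕜 H) (_ : CompleteSpace H),
      Nonempty (Y ≃ₗᵢ[𝕜] TwoSum X H) := by
  choose d hd using hJ
  let D : X →ₗᵢ[𝕜] Y :=
    { toFun := d
      map_add' := fun x y => J.injective (by simp only [map_add, hd])
      map_smul' := fun c x => J.injective (by simp only [map_smul, hd, RingHom.id_apply])
      norm_map' := fun x => by
        change ‖d x‖ = _
        rw [← J.norm_map, hd, LinearIsometry.norm_map] }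
  have hD : ∀ x, J (D x) = WithLp.toLp 2 (x, 0) := hd
  let L : Y →ₗ[𝕜] X := (WithLp.fstL 2 𝕜 X H).toLinearMap ∘ₗ J.toLinearMap
  have hL : ∀ y, L y = (J y).fst := fun y => rfl
  refine exists_equiv_twoSum_hilbert D L (fun x => by rw [hL, hD]; rfl) (fun v => ?_) ?_
  · have h1 : J (v - D (L v)) = WithLp.toLp 2 (0, (J v).snd) := by
      rw [map_sub, hD, hL, sub_eq_iff_eq_add, ← WithLp.toLp_add, Prod.mk_add_mk, zero_add, add_zero]
      rfl
    rw [← J.norm_map v, ← J.norm_map (v - _), h1, WithLp.norm_toLp_snd, hL]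
    exact WithLp.prod_norm_sq_eq_of_L2 _
  -- On the kernel of `L`, the map `J` takes values in the summand `H`, so the parallelogram law is
  -- inherited.
  · intro v w hv hw
    have key : ∀ v, L v = 0 → ‖v‖ = ‖(J v).snd‖ := fun v hv => by
      have := WithLp.prod_norm_sq_eq_of_L2 (J v)
      rw [J.norm_map, ← hL, hv, norm_zero, zero_pow two_ne_zero, zero_add] at this
      exact (sq_eq_sq₀ (norm_nonneg _) (norm_nonneg _)).1 this
    rw [key v hv, key w hw, key (v + w) (by rw [map_add, hv, hw, add_zero]),
      key (v - w) (by rw [map_sub, hv, hw, sub_zero]), map_add, map_sub]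
    have := parallelogram_law_with_norm 𝕜 (J v).snd (J w).snd
    exact this.le

/-- Under the categoricity criterion, every member of the elementary class of `X` is the 2-sum of
`X` with a Hilbert space. -/
theorem CategoricityCriterion.exists_equiv (hX : CategoricityCriterion 𝕜 X) {Y : Type u}
    [NormedAddCommGroup Y] [NormedSpace 𝕜 Y] [CompleteSpace Y]
    (h : ElementarilyEquivalent 𝕜 X Y) :
    ∃ (H : Type u) (_ : NormedAddCommGroup H) (_ : InnerProductSpace 𝕜 H) (_ : CompleteSpace H),
      Nonempty (Y ≃ₗᵢ[𝕜] TwoSum X H) := by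
  obtain ⟨I, K, U, V, ⟨e⟩⟩ := h
  obtain ⟨H, _, _, _, ⟨Θ⟩⟩ := hX.ultrapower I U
  obtain ⟨H', _, _, _, ⟨Θ'⟩⟩ := hX.ultrapower K V
  let ip : InnerProductSpace 𝕜 (Ultrapower 𝕜 V H) := Ultrapower.innerProductSpace
  let J : Y →ₗᵢ[𝕜] TwoSum X H :=
    (e.symm.trans Θ).toLinearIsometry.comp (diag 𝕜 V)
  let Ψ : TwoSum X H →ₗᵢ[𝕜] Ultrapower 𝕜 V Y := (Θ.symm.trans e).toLinearIsometry
  -- The ultrapower of X ⊕₂ H is again X plus a Hilbert space, so rigidity applies to every copy of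
  -- X in it.
  let Q : Ultrapower 𝕜 V (TwoSum X H) →ₗᵢ[𝕜] TwoSum X (TwoSum H' (Ultrapower 𝕜 V H)) :=
    ((LinearIsometryEquiv.withLpProdCongr 2 Θ' (LinearIsometryEquiv.refl 𝕜 _)).trans
      (LinearIsometryEquiv.withLpProdAssoc 2 𝕜 X H' (Ultrapower 𝕜 V H))).toLinearIsometry.comp
      (prodMap 𝕜 V X H)
  have hS := hX.rigid (TwoSum H' (Ultrapower 𝕜 V H))
    (Q.comp ((Ultrapower.map V J).comp (Ψ.comp (twoSumInl 𝕜 X H))))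
  have hS' := hX.rigid (TwoSum H' (Ultrapower 𝕜 V H))
    (Q.comp ((diag 𝕜 V).comp (twoSumInl 𝕜 X H)))
  refine exists_equiv_of_inl_mem_range J fun x => ?_
  -- Two copies of X are compared: the diagonal one and the one coming through the ultrapower of Y.
  -- By rigidity both fill the summand X, hence they coincide.
  have hx : Q (diag 𝕜 V (twoSumInl 𝕜 X H x)) ∈
      Set.range (Q.comp ((Ultrapower.map V J).comp (Ψ.comp (twoSumInl 𝕜 X H)))) := by
    rw [hS, ← hS']
    exact ⟨x, rfl⟩
  obtain ⟨x', hx'⟩ := hx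
  have hx2 : Ultrapower.map V J (Ψ (twoSumInl 𝕜 X H x')) = diag 𝕜 V (twoSumInl 𝕜 X H x) :=
    Q.injective hx'
  obtain ⟨y, hy⟩ := cls_surjective (Ψ (twoSumInl 𝕜 X H x'))
  -- The constant family is thus the class of a family `J (y i)`, so its value is a limit of points
  -- of the closed range of `J`.
  rw [← hy, map_cls, cls_eq_diag_iff] at hx2
  have hcl : IsClosed (Set.range J) := J.isometry.isClosedEmbedding.isClosed_range
  exact hcl.mem_of_tendsto hx2 (Eventually.of_forall fun i => ⟨y i, rfl⟩)

end Structure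

/-! ### Density characters and Hilbert dimension. -/

section Density

lemma exists_dense_mk_eq_densityCharacter (X : Type u) [TopologicalSpace X] :
    ∃ s : Set X, Dense s ∧ #s = densityCharacter X :=
  csInf_mem (s := {κ | ∃ s : Set X, Dense s ∧ #s = κ}) ⟨_, Set.univ, dense_univ, rfl⟩

lemma densityCharacter_le {X : Type u} [TopologicalSpace X] {s : Set X} (hs : Dense s) :
    densityCharacter X ≤ #s :=
  csInf_le' ⟨s, hs, rfl⟩

lemma densityCharacter_le_of_surjective {X Y : Type u} [TopologicalSpace X] [TopologicalSpace Y]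
    {f : X → Y} (hf : Function.Surjective f) (hc : Continuous f) :
    densityCharacter Y ≤ densityCharacter X := by
  obtain ⟨s, hs, h⟩ := exists_dense_mk_eq_densityCharacter X
  rw [← h]
  exact (densityCharacter_le (hf.denseRange.dense_image hc hs)).trans mk_image_le

lemma densityCharacter_congr {X Y : Type u} [TopologicalSpace X] [TopologicalSpace Y]
    (e : X ≃ₜ Y) : densityCharacter X = densityCharacter Y :=
  le_antisymm (densityCharacter_le_of_surjective e.symm.surjective e.symm.continuous)
    (densityCharacter_le_of_surjective e.surjective e.continuous)

/-- Points of a dense set chosen within 1/2 of the members of a 1-separated family are distinct. -/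
lemma mk_le_densityCharacter {X ι : Type u} [PseudoMetricSpace X] (f : ι → X)
    (hf : Pairwise fun i j => 1 ≤ dist (f i) (f j)) : #ι ≤ densityCharacter X := by
  obtain ⟨s, hs, h⟩ := exists_dense_mk_eq_densityCharacter X
  rw [← h]
  choose g hgs hg using fun i => hs.exists_dist_lt (f i) (by norm_num : (0 : ℝ) < 1 / 2)
  refine mk_le_of_injective (f := fun i => (⟨g i, hgs i⟩ : s)) fun i j hij => ?_
  by_contra hne
  have h1 := hf hne
  have h2 := dist_triangle (f i) (g i) (f j)
  have h3 : g i = g j := congrArg Subtype.val hij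
  have h4 := hg j
  have h5 := hg i
  rw [dist_comm, ← h3] at h4
  linarith

/-- The closed span of a family has density character at most that of the family. -/
lemma densityCharacter_le_of_span {𝕜 : Type*} [RCLike 𝕜] {H ι : Type u} [NormedAddCommGroup H]
    [NormedSpace 𝕜 H] (b : ι → H) (hb : Dense (Submodule.span 𝕜 (Set.range b) : Set H)) :
    densityCharacter H ≤ max #ι ℵ₀ := by
  obtain ⟨d, hd⟩ := TopologicalSpace.exists_dense_seq 𝕜
  -- Combinations with coefficients in a countable dense set, coded by lists: concatenation becomes
  -- addition and the codes are easily counted.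
  let φ : List (ULift.{u} ℕ × ι) → H := fun l => (l.map fun p => d p.1.down • b p.2).sum
  have hφ : ∀ l l', φ (l ++ l') = φ l + φ l' := fun l l' => by simp [φ]
  have hadd : ∀ x ∈ closure (Set.range φ), ∀ y ∈ closure (Set.range φ),
      x + y ∈ closure (Set.range φ) := fun x hx y hy =>
    map_mem_closure₂ continuous_add hx hy (by
      rintro _ ⟨l, rfl⟩ _ ⟨l', rfl⟩
      exact ⟨l ++ l', hφ l l'⟩)
  have hsmul : ∀ (c : 𝕜) (i : ι), c • b i ∈ closure (Set.range φ) := fun c i => by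
    have h : Set.range (fun n => d n • b i) ⊆ Set.range φ := by
      rintro _ ⟨n, rfl⟩
      exact ⟨[(⟨n⟩, i)], by simp [φ]⟩
    refine closure_mono h ?_
    have hc : Continuous fun c : 𝕜 => c • b i := by fun_prop
    have := image_closure_subset_closure_image (s := Set.range d) hc ⟨c, hd c, rfl⟩
    rwa [← Set.range_comp] at this
  have hspan : ∀ x ∈ Submodule.span 𝕜 (Set.range b), x ∈ closure (Set.range φ) := by
    intro x hx
    obtain ⟨c, rfl⟩ := Finsupp.mem_span_range_iff_exists_finsupp.1 hx
    exact Finset.sum_induction _ (· ∈ closure (Set.range φ)) (fun x y hx hy => hadd x hx y hy)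
      (subset_closure ⟨[], rfl⟩) fun i _ => hsmul _ i
  have hdense : Dense (Set.range φ) := by
    have : Dense (closure (Set.range φ)) := hb.mono hspan
    exact dense_closure.1 this
  refine (densityCharacter_le hdense).trans (mk_range_le.trans ?_)
  refine (mk_list_le_max _).trans ?_
  rw [mk_prod, lift_id, lift_id]
  refine max_le (le_max_right _ _) ((mul_le_max _ _).trans ?_)
  exact max_le (max_le (by simp) (le_max_left _ _)) (le_max_right _ _)

lemma densityCharacter_twoSum_le {X H : Type u} [NormedAddCommGroup X] [NormedAddCommGroup H]
    [TopologicalSpace.SeparableSpace X] :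
    densityCharacter (TwoSum X H) ≤ max (densityCharacter H) ℵ₀ := by
  obtain ⟨s, hs, h⟩ := exists_dense_mk_eq_densityCharacter H
  obtain ⟨t, ht, htd⟩ := TopologicalSpace.exists_countable_dense X
  have hd : Dense ((WithLp.toLp 2 : X × H → TwoSum X H) '' (t ×ˢ s)) :=
    (WithLp.toLp_surjective 2).denseRange.dense_image (WithLp.prod_continuous_toLp 2 X H)
      (htd.prod hs)
  refine (densityCharacter_le hd).trans (mk_image_le.trans ?_)
  rw [mk_setProd, h]
  refine (mul_le_max _ _).trans (max_le (max_le ?_ (le_max_left _ _)) (le_max_right _ _))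
  exact (le_aleph0_iff_set_countable.2 ht).trans (le_max_right _ _)

/-- The cardinality of a Hilbert basis of the Hilbertian summand of a nonseparable space. -/
lemma HilbertBasis.mk_eq_densityCharacter {𝕜 : Type*} [RCLike 𝕜] {X H ι : Type u}
    [NormedAddCommGroup X] [TopologicalSpace.SeparableSpace X]
    [NormedAddCommGroup H] [InnerProductSpace 𝕜 H] (b : HilbertBasis ι 𝕜 H)
    (h : ℵ₀ < densityCharacter (TwoSum X H)) : #ι = densityCharacter (TwoSum X H) := by
  refine le_antisymm (mk_le_densityCharacter (fun i => WithLp.toLp 2 (0, b i)) ?_) ?_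
  · intro i j hij
    have h1 : ‖b i - b j‖ ^ 2 = 2 := by
      rw [@norm_sub_sq 𝕜, b.orthonormal.2 hij, b.orthonormal.1, b.orthonormal.1]
      norm_num
    rw [WithLp.dist_toLp_snd, dist_eq_norm]
    nlinarith [norm_nonneg (b i - b j)]
  · have h1 := densityCharacter_le_of_span (𝕜 := 𝕜) b
      (Submodule.dense_iff_topologicalClosure_eq_top.2 b.dense_span)
    have h2 := (densityCharacter_twoSum_le (X := X) (H := H)).trans
      (max_le (h1.trans (le_refl _)) (le_max_right _ _))
    rcases le_max_iff.1 h2 with h3 | h3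
    · exact h3
    · exact absurd h3 (not_le.2 h)

/-- Hilbert spaces with equipotent Hilbert bases are isometric. -/
lemma HilbertBasis.nonempty_equiv {𝕜 : Type*} [RCLike 𝕜] {H H' ι ι' : Type*}
    [NormedAddCommGroup H] [InnerProductSpace 𝕜 H] [CompleteSpace H]
    [NormedAddCommGroup H'] [InnerProductSpace 𝕜 H']
    (b : HilbertBasis ι 𝕜 H) (b' : HilbertBasis ι' 𝕜 H') (e : ι' ≃ ι) :
    Nonempty (H ≃ₗᵢ[𝕜] H') := by
  have hr : Set.range (b ∘ e) = Set.range b := e.surjective.range_comp b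
  let c : HilbertBasis ι' 𝕜 H := HilbertBasis.mk (b.orthonormal.comp e e.injective)
    (by rw [hr, b.dense_span])
  exact ⟨c.repr.trans b'.repr.symm⟩

end Density

/-! ### A nonseparable member of the class, and the criterion. -/

section Existence

/-- A free ultrapower of an infinite dimensional space is not separable. -/
lemma aleph0_lt_densityCharacter_ultrapower {𝕜 : Type*} [RCLike 𝕜] {X : Type u}
    [NormedAddCommGroup X] [NormedSpace 𝕜 X] (hX : ¬ FiniteDimensional 𝕜 X) :
    ℵ₀ < densityCharacter (Ultrapower 𝕜 (Filter.hyperfilter (ULift.{u} ℕ)) X) := by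
  obtain ⟨R, f, -, hR, hf⟩ := exists_seq_norm_le_one_le_norm_sub (𝕜 := 𝕜) (E := X) hX
  -- The code of the first n bits: two branches of the binary tree have different codes from their
  -- first disagreement on. This gives continuum many 1-separated classes.
  let c : (ℕ → Bool) → ℕ → ℕ := fun α n => Encodable.encode (List.ofFn fun i : Fin n => α i)
  have hc : ∀ {α β : ℕ → Bool} {k n : ℕ}, α k ≠ β k → k < n → c α n ≠ c β n := by
    intro α β k n hk hkn h
    have h1 := List.ofFn_injective (Encodable.encode_injective h)
    exact hk (congrFun h1 ⟨k, hkn⟩)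
  let x : ULift.{u} (ℕ → Bool) → lp (fun _ : ULift.{u} ℕ => X) ∞ := fun α =>
    Ultrapower.bdd (fun n => f (c α.down n.down)) ⟨R, fun _ => hR _⟩
  have h := mk_le_densityCharacter
    (fun α => Ultrapower.cls 𝕜 (Filter.hyperfilter (ULift.{u} ℕ)) (x α)) (fun α β hαβ => by
      obtain ⟨k, hk⟩ := Function.ne_iff.1 (fun h => hαβ (ULift.down_injective h))
      rw [dist_eq_norm, ← map_sub]
      refine ge_of_tendsto (Ultrapower.tendsto_norm_cls (x α - x β)) ?_
      have hev : ∀ᶠ n : ULift.{u} ℕ in cofinite, k < n.down := by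
        rw [Filter.eventually_cofinite]
        refine ((Set.finite_Iic k).preimage ULift.down_injective.injOn).subset fun n hn => ?_
        simpa using hn
      filter_upwards [Filter.hyperfilter_le_cofinite hev] with n hn
      exact hf (hc hk hn))
  refine lt_of_lt_of_le ?_ h
  simpa using Cardinal.cantor ℵ₀

end Existence

/-- The categoricity criterion for separable spaces. -/
theorem CategoricityCriterion.isUncountablyCategorical {𝕜 : Type*} [RCLike 𝕜] {X : Type u}
    [NormedAddCommGroup X] [NormedSpace 𝕜 X] [TopologicalSpace.SeparableSpace X]
    (hX : CategoricityCriterion 𝕜 X) : IsUncountablyCategorical 𝕜 X := by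
  have := hX.complete
  -- The cardinal is the density character of a free ultrapower of X, which is its own witness: its
  -- ultrapower over a one-point index set is itself.
  refine ⟨hX.complete, hX.infinite_dimensional, _,
    aleph0_lt_densityCharacter_ultrapower hX.infinite_dimensional, ⟨_, inferInstance, inferInstance,
      inferInstance, ⟨ULift ℕ, PUnit, Filter.hyperfilter (ULift ℕ), pure PUnit.unit, ?_⟩, rfl⟩, ?_⟩
  · refine ⟨LinearIsometryEquiv.ofSurjective (Ultrapower.diag 𝕜 (pure PUnit.unit)) fun v => ?_⟩
    obtain ⟨x, rfl⟩ := Ultrapower.cls_surjective v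
    exact ⟨x PUnit.unit, (Ultrapower.cls_eq_diag_iff.2 (tendsto_pure_nhds _ _)).symm⟩
  · intro Y Z _ _ _ _ _ _ hY hYκ hZ hZκ
    have hκ := aleph0_lt_densityCharacter_ultrapower (𝕜 := 𝕜) hX.infinite_dimensional
    obtain ⟨H, _, _, _, ⟨e⟩⟩ := hX.exists_equiv hY
    obtain ⟨H', _, _, _, ⟨e'⟩⟩ := hX.exists_equiv hZ
    obtain ⟨w, b, -⟩ := exists_hilbertBasis 𝕜 H
    obtain ⟨w', b', -⟩ := exists_hilbertBasis 𝕜 H'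
    rw [densityCharacter_congr e.toHomeomorph] at hYκ
    rw [densityCharacter_congr e'.toHomeomorph] at hZκ
    have h1 := b.mk_eq_densityCharacter (X := X) (hYκ ▸ hκ)
    have h2 := b'.mk_eq_densityCharacter (X := X) (hZκ ▸ hκ)
    obtain ⟨f⟩ := Cardinal.eq.1 (h2.trans (hZκ.trans (hYκ.symm.trans h1.symm)))
    obtain ⟨g⟩ := b.nonempty_equiv b' f
    exact ⟨e.trans ((LinearIsometryEquiv.withLpProdCongr 2
      (LinearIsometryEquiv.refl 𝕜 X) g).trans e'.symm)⟩

end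

/-! ### Real inequalities behind the comparison of exponents. -/

section RealInequalities

/-- Increments of a convex function grow: x + u and y are convex combinations of x and y + u with
exchanged weights. -/
lemma ConvexOn.add_le_add_of_le {f : ℝ → ℝ} (hf : ConvexOn ℝ (Set.Ici 0) f) {x y u : ℝ}
    (hx : 0 ≤ x) (hxy : x ≤ y) (hu : 0 ≤ u) : f (x + u) + f y ≤ f x + f (y + u) := by
  rcases hu.eq_or_lt with rfl | hu
  · simp
  have hd : 0 < y + u - x := by linarith
  have hx' : x ∈ Set.Ici (0 : ℝ) := hx
  have hy' : y + u ∈ Set.Ici (0 : ℝ) := by simp only [Set.mem_Ici]; linarith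
  have ha : 0 ≤ (y - x) / (y + u - x) := div_nonneg (by linarith) hd.le
  have hb : 0 ≤ u / (y + u - x) := div_nonneg hu.le hd.le
  have hab : (y - x) / (y + u - x) + u / (y + u - x) = 1 := by field_simp; ring
  have h1 := hf.2 hx' hy' ha hb hab
  have h2 := hf.2 hx' hy' hb ha (by rw [add_comm, hab])
  simp only [smul_eq_mul] at h1 h2
  have e1 : (y - x) / (y + u - x) * x + u / (y + u - x) * (y + u) = x + u := by field_simp; ring
  have e2 : u / (y + u - x) * x + (y - x) / (y + u - x) * (y + u) = y := by field_simp; ring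
  rw [e1] at h1
  rw [e2] at h2
  have e3 : ((y - x) / (y + u - x) + u / (y + u - x)) * f x = f x := by rw [hab, one_mul]
  have e4 : ((y - x) / (y + u - x) + u / (y + u - x)) * f (y + u) = f (y + u) := by
    rw [hab, one_mul]
  linarith

lemma rpow_rpow_two_div {a p : ℝ} (ha : 0 ≤ a) (hp : 0 < p) : (a ^ p) ^ (2 / p) = a ^ 2 := by
  rw [← Real.rpow_mul ha, mul_div_cancel₀ _ hp.ne', Real.rpow_two]

lemma sq_rpow_add_le {a b p r : ℝ} (ha : 0 ≤ a) (hb : 0 ≤ b) (hp : 0 < p) (hpr : p ≤ r) :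
    (a ^ r + b ^ r) ^ (2 / r) ≤ (a ^ p + b ^ p) ^ (2 / p) := by
  have h := Real.rpow_add_rpow_le ha hb hp hpr
  have h' := pow_le_pow_left₀ (by positivity) h 2
  rw [← Real.rpow_two, ← Real.rpow_two, ← Real.rpow_mul (by positivity),
    ← Real.rpow_mul (by positivity)] at h'
  simpa [div_eq_mul_inv, mul_comm] using h'

/-- In the variable τ = t^s the left side is convex, hence lies below its chord on [0, 1]. This
makes the coordinates of exponent at least s contribute only O(t^s). -/
lemma sq_rpow_add_mul_le {a b s t : ℝ} (ha : 0 ≤ a) (hb : 0 ≤ b) (hs1 : 1 ≤ s) (hs2 : s ≤ 2)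
    (ht0 : 0 ≤ t) (ht1 : t ≤ 1) :
    (a ^ s + (t * b) ^ s) ^ (2 / s) ≤ a ^ 2 + 2 * t ^ s * (a ^ 2 + b ^ 2) := by
  have hs0 : 0 < s := by linarith
  have hθ : 1 ≤ 2 / s := by rw [le_div_iff₀ hs0]; linarith
  have hθ2 : 2 / s - 1 ≤ 1 := by
    have : 2 / s ≤ 2 := by rw [div_le_iff₀ hs0]; linarith
    linarith
  have hτ1 : t ^ s ≤ 1 := Real.rpow_le_one ht0 ht1 hs0.le
  have hτ0 : 0 ≤ t ^ s := by positivity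
  have hA : 0 ≤ a ^ s := by positivity
  have hB : 0 ≤ b ^ s := by positivity
  have h1 := (convexOn_rpow hθ).2 (show a ^ s ∈ Set.Ici (0 : ℝ) from hA)
    (show a ^ s + b ^ s ∈ Set.Ici (0 : ℝ) from add_nonneg hA hB) (sub_nonneg.2 hτ1) hτ0
    (sub_add_cancel 1 (t ^ s))
  simp only [smul_eq_mul] at h1
  rw [show (1 - t ^ s) * a ^ s + t ^ s * (a ^ s + b ^ s) = a ^ s + t ^ s * b ^ s by ring,
    ← Real.mul_rpow ht0 hb] at h1
  have h2 : (a ^ s + b ^ s) ^ (2 / s) ≤ 2 * (a ^ 2 + b ^ 2) := by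
    have h2 : (a ^ s + b ^ s) ^ (2 / s) ≤
        2 ^ (2 / s - 1) * ((a ^ s) ^ (2 / s) + (b ^ s) ^ (2 / s)) := by
      lift a to NNReal using ha
      lift b to NNReal using hb
      exact_mod_cast NNReal.rpow_add_le_mul_rpow_add_rpow (a ^ s) (b ^ s) hθ
    refine h2.trans ?_
    rw [rpow_rpow_two_div ha hs0, rpow_rpow_two_div hb hs0]
    refine mul_le_mul_of_nonneg_right ?_ (by positivity)
    calc (2 : ℝ) ^ (2 / s - 1) ≤ 2 ^ (1 : ℝ) := Real.rpow_le_rpow_of_exponent_le one_le_two hθ2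
      _ = 2 := Real.rpow_one 2
  have h3 := mul_le_mul_of_nonneg_left h2 hτ0
  rw [rpow_rpow_two_div ha hs0] at h1
  nlinarith [mul_nonneg hτ0 (sq_nonneg a)]

/-- Minkowski's inequality in ℓ_{2/p} for the p-th powers. It merges all coordinates of one exponent
into a single pair of numbers. -/
lemma sum_sq_rpow_add_le {ι : Type*} (S : Finset ι) (a b : ι → ℝ) {p t : ℝ} (ha : ∀ i, 0 ≤ a i)
    (hb : ∀ i, 0 ≤ b i) (hp : 0 < p) (hp2 : p ≤ 2) (ht : 0 ≤ t) :
    ∑ i ∈ S, (a i ^ p + (t * b i) ^ p) ^ (2 / p) ≤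
      ((∑ i ∈ S, a i ^ 2) ^ (p / 2) + t ^ p * (∑ i ∈ S, b i ^ 2) ^ (p / 2)) ^ (2 / p) := by
  have hθ : 1 ≤ 2 / p := by rw [le_div_iff₀ hp]; linarith
  have h := Real.Lp_add_le_of_nonneg S hθ (f := fun i => a i ^ p) (g := fun i => (t * b i) ^ p)
    (fun i _ => Real.rpow_nonneg (ha i) _)
    (fun i _ => Real.rpow_nonneg (mul_nonneg ht (hb i)) _)
  simp only [rpow_rpow_two_div (ha _) hp, rpow_rpow_two_div (mul_nonneg ht (hb _)) hp,
    one_div_div, mul_pow, ← Finset.mul_sum] at h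
  rw [Real.mul_rpow (by positivity) (Finset.sum_nonneg fun i _ => sq_nonneg _),
    ← Real.rpow_natCast t 2, ← Real.rpow_mul ht] at h
  rw [show ((2 : ℕ) : ℝ) * (p / 2) = p by push_cast; ring] at h
  have h0 : 0 ≤ ∑ i ∈ S, (a i ^ p + (t * b i) ^ p) ^ (2 / p) :=
    Finset.sum_nonneg fun i _ => Real.rpow_nonneg (add_nonneg (Real.rpow_nonneg (ha i) _)
      (Real.rpow_nonneg (mul_nonneg ht (hb i)) _)) _
  have h' := Real.rpow_le_rpow (Real.rpow_nonneg h0 _) h (by positivity : 0 ≤ 2 / p)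
  rwa [← Real.rpow_mul h0, show p / 2 * (2 / p) = 1 by field_simp, Real.rpow_one] at h'

lemma le_zero_of_le_mul_rpow {c K δ : ℝ} (hδ : 0 < δ)
    (h : ∀ t : ℝ, 0 < t → t ≤ 1 → c ≤ K * t ^ δ) : c ≤ 0 := by
  have h1 : Tendsto (fun t : ℝ => K * t ^ δ) (𝓝[>] 0) (𝓝 (K * 0 ^ δ)) :=
    (((Real.continuousAt_rpow_const 0 δ (Or.inr hδ.le)).tendsto).const_mul K).mono_left
      nhdsWithin_le_nhds
  rw [Real.zero_rpow hδ.ne', mul_zero] at h1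
  refine ge_of_tendsto h1 ?_
  filter_upwards [self_mem_nhdsWithin, Ioc_mem_nhdsGT (zero_lt_one' ℝ)] with t _ ht
  exact h t ht.1 ht.2

/-- Convexity of x^(2/p) reduces to A = 1. Then, with β = B^(p/2), the difference of the powers of 1
+ t^p and 1 + t^p β is at least t^p (1 - β), so 1 - β ≤ K t^(s-p), and t → 0. -/
lemma one_le_of_rpow_expansion {p s K A B : ℝ} (hp : 0 < p) (hp2 : p < 2) (hs : p < s)
    (hA0 : 0 ≤ A) (hA1 : A ≤ 1) (hB0 : 0 ≤ B)
    (h : ∀ t : ℝ, 0 < t → t ≤ 1 → (1 + t ^ p) ^ (2 / p) ≤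
      1 + K * t ^ s + ((A ^ (p / 2) + t ^ p * B ^ (p / 2)) ^ (2 / p) - A)) : 1 ≤ B := by
  have hθ : 1 ≤ 2 / p := by rw [le_div_iff₀ hp]; linarith
  by_contra! hB
  have hβ1 : B ^ (p / 2) < 1 := Real.rpow_lt_one hB0 hB (by positivity)
  have hα1 : A ^ (p / 2) ≤ 1 := Real.rpow_le_one hA0 hA1 (by positivity)
  have hα0 : 0 ≤ A ^ (p / 2) := by positivity
  have hβ0 : 0 ≤ B ^ (p / 2) := by positivity
  have hαA : (A ^ (p / 2)) ^ (2 / p) = A := by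
    rw [← Real.rpow_mul hA0, show p / 2 * (2 / p) = 1 by field_simp, Real.rpow_one]
  generalize A ^ (p / 2) = α at *
  generalize B ^ (p / 2) = β at *
  refine absurd (le_zero_of_le_mul_rpow (c := 1 - β) (K := K) (sub_pos.2 hs) fun t ht0 ht1 => ?_)
    (by linarith)
  have h1 := h t ht0 ht1
  have hτ : 0 < t ^ p := by positivity
  have h2 := (convexOn_rpow hθ).add_le_add_of_le hα0 hα1 (mul_nonneg hτ.le hβ0)
  simp only [hαA, Real.one_rpow] at h2
  have hz : 1 ≤ 1 + t ^ p * β := by nlinarith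
  have hzy : 1 + t ^ p * β ≤ 1 + t ^ p := by nlinarith
  have h3 : (1 + t ^ p) - (1 + t ^ p * β) ≤ (1 + t ^ p) ^ (2 / p) - (1 + t ^ p * β) ^ (2 / p) := by
    generalize 1 + t ^ p = y at *
    generalize 1 + t ^ p * β = z at *
    have e : ∀ x : ℝ, 1 ≤ x → x ^ (2 / p) = x * x ^ (2 / p - 1) := fun x hx => by
      rw [Real.rpow_sub_one (by linarith), mul_div_cancel₀ _ (by linarith)]
    rw [e y (hz.trans hzy), e z hz]
    have hm : z ^ (2 / p - 1) ≤ y ^ (2 / p - 1) :=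
      Real.rpow_le_rpow (by linarith) hzy (by linarith)
    have hm1 : 1 ≤ z ^ (2 / p - 1) := Real.one_le_rpow hz (by linarith)
    nlinarith
  have h4 : t ^ p * (1 - β) ≤ K * t ^ s := by linarith
  rw [Real.rpow_sub ht0, ← mul_div_assoc, le_div_iff₀ hτ]
  linarith

/-- Concavity of x^(2/r) reduces to a = 1, where the chord over [1, 2] gives a lower bound of order
(tb)^r. The right side allows only t^q, and q > r. -/
lemma eq_zero_of_rpow_expansion {q r a b : ℝ} (hr : 2 ≤ r) (hq : r < q) (ha0 : 0 ≤ a)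
    (ha1 : a ≤ 1) (hb0 : 0 ≤ b) (hb1 : b ≤ 1)
    (h : ∀ t : ℝ, 0 < t → t ≤ 1 →
      1 - a ^ 2 + (a ^ r + (t * b) ^ r) ^ (2 / r) ≤ (1 + t ^ q) ^ (2 / q)) : b = 0 := by
  have hr0 : 0 < r := by linarith
  have hq0 : 0 < q := by linarith
  have hθ1 : 2 / r ≤ 1 := by rw [div_le_iff₀ hr0]; linarith
  have hθ0 : 0 < 2 / r := by positivity
  have hconc := Real.concaveOn_rpow hθ0.le hθ1
  have hc : 0 < (2 : ℝ) ^ (2 / r) - 1 := by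
    have := Real.one_lt_rpow one_lt_two hθ0
    linarith
  have hle : ((2 : ℝ) ^ (2 / r) - 1) * b ^ r ≤ 0 := by
    refine le_zero_of_le_mul_rpow (K := 1) (sub_pos.2 hq) fun t ht0 ht1 => ?_
    have h1 := h t ht0 ht1
    have hx0 : 0 ≤ (t * b) ^ r := by positivity
    have hx1 : (t * b) ^ r ≤ 1 := Real.rpow_le_one (by positivity) (by nlinarith) hr0.le
    have h2 := hconc.neg.add_le_add_of_le (Real.rpow_nonneg ha0 r)
      (Real.rpow_le_one ha0 ha1 hr0.le) hx0
    simp only [Pi.neg_apply, rpow_rpow_two_div ha0 hr0, Real.one_rpow] at h2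
    have h3 := hconc.2 (show (1 : ℝ) ∈ Set.Ici (0 : ℝ) by simp)
      (show (2 : ℝ) ∈ Set.Ici (0 : ℝ) by simp) (sub_nonneg.2 hx1) hx0 (sub_add_cancel 1 _)
    simp only [smul_eq_mul, Real.one_rpow] at h3
    rw [show (1 - (t * b) ^ r) * 1 + (t * b) ^ r * 2 = 1 + (t * b) ^ r by ring] at h3
    have h4 : (1 + t ^ q) ^ (2 / q) ≤ 1 + t ^ q := by
      have hq1 : 2 / q ≤ 1 := by rw [div_le_iff₀ hq0]; linarith
      calc (1 + t ^ q) ^ (2 / q) ≤ (1 + t ^ q) ^ (1 : ℝ) :=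
            Real.rpow_le_rpow_of_exponent_le (by have := Real.rpow_pos_of_pos ht0 q; linarith) hq1
        _ = _ := Real.rpow_one _
    have h5 : (t * b) ^ r * ((2 : ℝ) ^ (2 / r) - 1) ≤ t ^ q := by linarith
    rw [Real.mul_rpow ht0.le hb0] at h5
    rw [one_mul, Real.rpow_sub ht0, le_div_iff₀ (by positivity)]
    linarith
  have hb : b ^ r ≤ 0 := by
    by_contra! hb
    exact absurd hle (not_le.2 (mul_pos hc hb))
  exact (Real.rpow_eq_zero hb0 hr0.ne').1 (le_antisymm hb (by positivity))

end RealInequalities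

/-! ### ℓ₂-sums, levels of equal exponent, and ℓ_p-pairs. -/

noncomputable section

section LpTwo

variable {G : ℕ → Type*} [∀ n, NormedAddCommGroup (G n)]

lemma lp_hasSum_norm_sq (f : lp G 2) : HasSum (fun n => ‖f n‖ ^ 2) (‖f‖ ^ 2) := by
  have h := lp.hasSum_norm (p := 2) (by norm_num) f
  simpa using h

lemma lp_norm_sq_sub_sum (f : lp G 2) (S : Finset ℕ) :
    ‖f - ∑ n ∈ S, lp.single 2 n (f n)‖ ^ 2 = ‖f‖ ^ 2 - ∑ n ∈ S, ‖f n‖ ^ 2 := by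
  have h := lp.norm_compl_sum_single (p := 2) (by norm_num) f S
  simpa using h

lemma lp_norm_sq_sub_single (f : lp G 2) (n : ℕ) :
    ‖f - lp.single 2 n (f n)‖ ^ 2 = ‖f‖ ^ 2 - ‖f n‖ ^ 2 := by
  simpa using lp_norm_sq_sub_sum f {n}

lemma lp_norm_single_add (n : ℕ) (y : G n) (a : lp G 2) (ha : a n = 0) :
    ‖lp.single 2 n y + a‖ ^ 2 = ‖y‖ ^ 2 + ‖a‖ ^ 2 := by
  have h := lp_norm_sq_sub_single (lp.single 2 n y + a) n
  have e : (lp.single 2 n y + a : lp G 2) n = y := by simp [ha]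
  rw [e, add_sub_cancel_left] at h
  linarith

/-- Doubling a coordinate adds (4 - 1)‖g n‖². Adding an orthogonal vector of the norm of `g n` adds
only ‖g n‖²; this contrast later forces coordinates to vanish. -/
lemma lp_norm_add_single_self {𝕜 : Type*} [RCLike 𝕜] [∀ n, NormedSpace 𝕜 (G n)] (n : ℕ)
    (g : lp G 2) : ‖g + lp.single 2 n (g n)‖ ^ 2 = ‖g‖ ^ 2 + 3 * ‖g n‖ ^ 2 := by
  have h1 := lp_norm_sq_sub_single (g + lp.single 2 n (g n)) n
  have h2 := lp_norm_sq_sub_single g n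
  have e : (g + lp.single 2 n (g n) : lp G 2) n = (2 : 𝕜) • g n := by simp [two_smul]
  rw [e, two_smul, lp.single_add, add_sub_add_right_eq_sub, ← two_smul 𝕜, norm_smul, h2] at h1
  norm_num at h1
  linarith

/-- The sequences supported on a level set of `c`. -/
def lpLevel (𝕜 : Type*) [RCLike 𝕜] (G : ℕ → Type*) [∀ n, NormedAddCommGroup (G n)]
    [∀ n, NormedSpace 𝕜 (G n)] (c : ℕ → ℝ) (n : ℕ) : Submodule 𝕜 (lp G 2) where
  carrier := {f | ∀ m, c m ≠ c n → f m = 0}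
  zero_mem' := by intro m _; simp
  add_mem' := by intro f g hf hg m hm; simp [hf m hm, hg m hm]
  smul_mem' := by intro _ f hf m hm; simp [hf m hm]

variable {𝕜 : Type*} [RCLike 𝕜] [∀ n, NormedSpace 𝕜 (G n)]

lemma mem_lpLevel {c : ℕ → ℝ} {n : ℕ} {f : lp G 2} :
    f ∈ lpLevel 𝕜 G c n ↔ ∀ m, c m ≠ c n → f m = 0 := Iff.rfl

lemma single_mem_lpLevel {c : ℕ → ℝ} {m n : ℕ} (h : c m = c n) (y : G m) :
    lp.single 2 m y ∈ lpLevel 𝕜 G c n := fun _ hk =>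
  lp.single_apply_ne _ _ _ fun hkm => hk (hkm ▸ h)

lemma eq_sum_single_of_mem_lpLevel {c : ℕ → ℝ} {n : ℕ} {S : Finset ℕ}
    (hS : ∀ m, m ∈ S ↔ c m = c n) {f : lp G 2} (hf : f ∈ lpLevel 𝕜 G c n) :
    f = ∑ m ∈ S, lp.single 2 m (f m) := by
  classical
  ext k
  rw [lp.coeFn_sum, Finset.sum_apply]
  by_cases hk : k ∈ S
  · rw [Finset.sum_eq_single_of_mem k hk fun m _ hm => lp.single_apply_ne _ _ _ hm.symm,
      lp.single_apply_self]
  · rw [hf k fun h => hk ((hS k).2 h)]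
    exact (Finset.sum_eq_zero fun m hm => lp.single_apply_ne _ _ _
      fun h => hk (by rwa [h])).symm

lemma finiteDimensional_lpLevel [∀ n, FiniteDimensional 𝕜 (G n)] {c : ℕ → ℝ} {n : ℕ}
    {S : Finset ℕ} (hS : ∀ m, m ∈ S ↔ c m = c n) : FiniteDimensional 𝕜 (lpLevel 𝕜 G c n) := by
  let φ : lpLevel 𝕜 G c n →ₗ[𝕜] ∀ m : S, G m :=
    LinearMap.pi fun m => lp.evalₗ (𝕜 := 𝕜) (E := G) 2 m ∘ₗ (lpLevel 𝕜 G c n).subtype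
  refine FiniteDimensional.of_injective φ fun f g hfg => Subtype.ext (lp.ext (funext fun m => ?_))
  by_cases hm : m ∈ S
  · exact congrFun hfg ⟨m, hm⟩
  · have h : c m ≠ c n := fun h => hm ((hS m).2 h)
    rw [f.2 m h, g.2 m h]

lemma tendsto_sum_single (f : lp G 2) :
    Tendsto (fun N => ∑ n ∈ Finset.range N, lp.single 2 n (f n)) atTop (𝓝 f) :=
  (lp.hasSum_single (by norm_num) f).tendsto_sum_nat

end LpTwo

section Levels

lemma finite_setOf_le_of_tendsto {c : ℕ → ℝ} {l : ℝ} (hc : Tendsto c atTop (𝓝 l)) {a : ℝ}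
    (ha : a < l) : {n | c n ≤ a}.Finite := by
  have := hc.eventually_const_lt ha
  rw [← Nat.cofinite_eq_atTop, Filter.eventually_cofinite] at this
  simpa using this

/-- Only finitely many values lie below a given one, since it is strictly below the limit; their
number is a rank. -/
lemma wellFounded_of_tendsto {c : ℕ → ℝ} {l : ℝ} (hc : Tendsto c atTop (𝓝 l))
    (hl : ∀ n, c n < l) : WellFounded fun m n => c m < c n := by
  refine Subrelation.wf (r := InvImage (· < ·) fun n => {m | c m < c n}.ncard) ?_
    (InvImage.wf _ wellFounded_lt)
  intro m n hmn
  refine Set.ncard_lt_ncard ⟨fun k hk => lt_trans hk hmn, fun h => ?_⟩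
    ((finite_setOf_le_of_tendsto hc (hl n)).subset fun k hk => (show c k < c n from hk).le)
  exact lt_irrefl (c m) (h (show m ∈ {k | c k < c n} from hmn))

variable {𝕜 : Type*} [RCLike 𝕜] {G : ℕ → Type*} [∀ n, NormedAddCommGroup (G n)]
  [∀ n, NormedSpace 𝕜 (G n)]
  {W : Type*} [NormedAddCommGroup W] [NormedSpace 𝕜 W]

lemma map_range_le_of_level_le {T J : lp G 2 →ₗᵢ[𝕜] W} [CompleteSpace (lp G 2)]
    (c : ℕ → ℝ)
    (h : ∀ n, (lpLevel 𝕜 G c n).map T.toLinearMap ≤ (lpLevel 𝕜 G c n).map J.toLinearMap) :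
    Set.range T ⊆ Set.range J := by
  have hcl : IsClosed (Set.range J) := J.isometry.isClosedEmbedding.isClosed_range
  rintro _ ⟨f, rfl⟩
  refine hcl.mem_of_tendsto ((T.continuous.tendsto f).comp (tendsto_sum_single f))
    (Eventually.of_forall fun N => ?_)
  have : T (∑ n ∈ Finset.range N, lp.single 2 n (f n)) ∈ LinearMap.range J.toLinearMap := by
    rw [map_sum]
    refine Submodule.sum_mem _ fun n _ => ?_
    have := h n (Submodule.mem_map_of_mem (single_mem_lpLevel rfl (f n)))
    exact LinearMap.map_le_range this
  exact this

/-- If two isometric embeddings of a 2-sum agree, level by level, on the image of the level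
once they agree on all the previous ones, then they have the same image. -/
theorem range_eq_of_level_step [∀ n, FiniteDimensional 𝕜 (G n)] {T J : lp G 2 →ₗᵢ[𝕜] W} {c : ℕ → ℝ} {l : ℝ}
    (hc : Tendsto c atTop (𝓝 l)) (hl : ∀ n, c n < l)
    (h : ∀ n, (∀ m, c m < c n →
      (lpLevel 𝕜 G c m).map T.toLinearMap = (lpLevel 𝕜 G c m).map J.toLinearMap) →
      ∃ (d : ℕ) (b : Module.Basis (Fin d) 𝕜 (G n)), ∀ j,
        T (lp.single 2 n (b j)) ∈ (lpLevel 𝕜 G c n).map J.toLinearMap) :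
    Set.range T = Set.range J := by
  have hG : ∀ n, CompleteSpace (G n) := fun n => FiniteDimensional.complete 𝕜 (G n)
  have hS : ∀ n, ∃ S : Finset ℕ, ∀ m, m ∈ S ↔ c m = c n := fun n => by
    have hfin : {m | c m = c n}.Finite :=
      (finite_setOf_le_of_tendsto hc (hl n)).subset fun m hm => le_of_eq hm
    exact ⟨hfin.toFinset, fun m => by simp⟩
  have hlev : ∀ n, (lpLevel 𝕜 G c n).map T.toLinearMap = (lpLevel 𝕜 G c n).map J.toLinearMap := by
    intro n
    induction n using (wellFounded_of_tendsto hc hl).induction with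
    | _ n ih =>
    obtain ⟨S, hS⟩ := hS n
    have := finiteDimensional_lpLevel (𝕜 := 𝕜) (G := G) hS
    have hle : (lpLevel 𝕜 G c n).map T.toLinearMap ≤ (lpLevel 𝕜 G c n).map J.toLinearMap := by
      rw [Submodule.map_le_iff_le_comap]
      intro f hf
      rw [Submodule.mem_comap, eq_sum_single_of_mem_lpLevel hS hf, map_sum]
      refine Submodule.sum_mem _ fun m hm => ?_
      have hmn := (hS m).1 hm
      have hlm : lpLevel 𝕜 G c m = lpLevel 𝕜 G c n := by
        ext g; rw [mem_lpLevel, mem_lpLevel, hmn]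
      obtain ⟨d, b, hb⟩ := h m fun k hk => ih k (by rwa [← hmn])
      rw [hlm] at hb
      have hsp : (⊤ : Submodule 𝕜 (G m)) ≤ ((lpLevel 𝕜 G c n).map J.toLinearMap).comap
          (T.toLinearMap ∘ₗ lp.lsingle 2 m) := by
        rw [← b.span_eq, Submodule.span_le]
        rintro _ ⟨j, rfl⟩
        exact hb j
      exact hsp (Submodule.mem_top (x := f m))
    -- `T` and `J` are injective, so both images have the finite dimension of the level.
    refine Submodule.eq_of_le_of_finrank_eq hle ?_
    rw [← (Submodule.equivMapOfInjective T.toLinearMap T.injective _).finrank_eq,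
      ← (Submodule.equivMapOfInjective J.toLinearMap J.injective _).finrank_eq]
  exact Set.Subset.antisymm (map_range_le_of_level_le c fun n => (hlev n).le)
    (map_range_le_of_level_le c fun n => (hlev n).ge)

end Levels

section Pairs

variable {𝕜 : Type*} [RCLike 𝕜] {X : Type*} [NormedAddCommGroup X] [NormedSpace 𝕜 X]

lemma IsLpPair.map {Y : Type*} [NormedAddCommGroup Y] [NormedSpace 𝕜 Y] {p : ℝ} {x y : X}
    (h : IsLpPair 𝕜 p x y) (T : X →ₗᵢ[𝕜] Y) : IsLpPair 𝕜 p (T x) (T y) := fun t => by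
  rw [← map_smul, ← map_add, T.norm_map]
  exact h t

lemma IsLpPair.norm_left {p : ℝ} (hp : 0 < p) {x y : X} (h : IsLpPair 𝕜 p x y) : ‖x‖ = 1 := by
  have h0 := h 0
  rw [RCLike.ofReal_zero, zero_smul, add_zero, abs_zero, Real.zero_rpow hp.ne', add_zero] at h0
  exact (Real.rpow_left_inj (norm_nonneg x) zero_le_one hp.ne').1 (by rw [h0, Real.one_rpow])

/-- By homogeneity ‖sx + y‖^p = s^p + 1 for s = 1/t > 0; then s → 0. -/
lemma IsLpPair.norm_right {p : ℝ} (hp : 0 < p) {x y : X} (h : IsLpPair 𝕜 p x y) : ‖y‖ = 1 := by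
  have h1 : Tendsto (fun s : ℝ => ‖(s : 𝕜) • x + y‖ ^ p) (𝓝[>] 0)
      (𝓝 (‖((0 : ℝ) : 𝕜) • x + y‖ ^ p)) := by
    refine Tendsto.mono_left (Continuous.tendsto ?_ 0) nhdsWithin_le_nhds
    exact (Continuous.norm (by fun_prop)).rpow_const fun _ => Or.inr hp.le
  have h2 : Tendsto (fun s : ℝ => s ^ p + 1) (𝓝[>] 0) (𝓝 (0 ^ p + 1)) :=
    (((Real.continuousAt_rpow_const 0 p (Or.inr hp.le)).tendsto).add_const 1).mono_left
      nhdsWithin_le_nhds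
  have h3 := tendsto_nhds_unique_of_eventuallyEq h1 h2 (by
    filter_upwards [self_mem_nhdsWithin] with s hs
    have hs : 0 < s := hs
    have hs' : (s : 𝕜) ≠ 0 := by exact_mod_cast hs.ne'
    have e : (s : 𝕜) • x + y = (s : 𝕜) • (x + ((s⁻¹ : ℝ) : 𝕜) • y) := by
      rw [smul_add, smul_smul, RCLike.ofReal_inv, mul_inv_cancel₀ hs', one_smul]
    rw [e, norm_smul, Real.mul_rpow (norm_nonneg _) (norm_nonneg _), h, RCLike.norm_ofReal,
      abs_of_pos hs, abs_of_pos (inv_pos.2 hs), mul_add, mul_one,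
      ← Real.mul_rpow hs.le (inv_pos.2 hs).le, mul_inv_cancel₀ hs.ne', Real.one_rpow])
  rw [RCLike.ofReal_zero, zero_smul, zero_add, Real.zero_rpow hp.ne', zero_add] at h3
  exact (Real.rpow_left_inj (norm_nonneg y) zero_le_one hp.ne').1 (by rw [h3, Real.one_rpow])

lemma IsLpPair.norm_sq_add_norm_sq_sub {p : ℝ} (hp : 0 < p) {x y : X} (h : IsLpPair 𝕜 p x y)
    {t : ℝ} (ht : 0 ≤ t) :
    ‖x + (t : 𝕜) • y‖ ^ 2 + ‖x - (t : 𝕜) • y‖ ^ 2 = 2 * (1 + t ^ p) ^ (2 / p) := by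
  have h1 := h t
  have h2 := h (-t)
  rw [RCLike.ofReal_neg, neg_smul, ← sub_eq_add_neg, abs_neg] at h2
  rw [← rpow_rpow_two_div (norm_nonneg (x + _)) hp, ← rpow_rpow_two_div (norm_nonneg (x - _)) hp,
    h1, h2, abs_of_nonneg ht]
  ring

end Pairs

end

/-! ### Expansions of ‖x + ty‖² + ‖x - ty‖² in E ⊕₂ F ⊕₂ H. -/

noncomputable section

section Expansions

variable {𝕜 : Type*} [RCLike 𝕜] {G : ℕ → Type*} [∀ n, NormedAddCommGroup (G n)]
  [∀ n, NormedSpace 𝕜 (G n)]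

lemma norm_ofReal_smul {X : Type*} [NormedAddCommGroup X] [NormedSpace 𝕜 X] {t : ℝ} (ht : 0 ≤ t)
    (x : X) : ‖(t : 𝕜) • x‖ = t * ‖x‖ := by
  rw [norm_smul, RCLike.norm_ofReal, abs_of_nonneg ht]

lemma lp_hasSum_add_sub (e f : lp G 2) :
    HasSum (fun n => ‖e n + f n‖ ^ 2 + ‖e n - f n‖ ^ 2) (‖e + f‖ ^ 2 + ‖e - f‖ ^ 2) :=
  (lp_hasSum_norm_sq (e + f)).add (lp_hasSum_norm_sq (e - f))

/-- Upper expansion in the `ℓ₂`-sum of spaces satisfying the `p`-inequalities. -/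
lemma lp_norm_sq_add_sub_le {p : ℕ → ℝ} (hp1 : ∀ n, 1 ≤ p n)
    (hG : ∀ n, ∀ x y : G n,
      ‖x + y‖ ^ 2 + ‖x - y‖ ^ 2 ≤ 2 * (‖x‖ ^ p n + ‖y‖ ^ p n) ^ (2 / p n))
    {p₀ s : ℝ} (hp₀ : 1 ≤ p₀) (hs : p₀ ≤ s) (hs2 : s ≤ 2) (S : Finset ℕ)
    (hS : ∀ m, m ∈ S ↔ p m = p₀) (hps : ∀ m, p m ≤ p₀ ∨ s ≤ p m) {e f : lp G 2}
    (hf : ∀ m, p m < p₀ → f m = 0) {t : ℝ} (ht0 : 0 < t) (ht1 : t ≤ 1) :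
    ‖e + (t : 𝕜) • f‖ ^ 2 + ‖e - (t : 𝕜) • f‖ ^ 2 ≤
      2 * ‖e‖ ^ 2 + 4 * t ^ s * (‖e‖ ^ 2 + ‖f‖ ^ 2) +
      ∑ m ∈ S, (2 * (‖e m‖ ^ p₀ + (t * ‖f m‖) ^ p₀) ^ (2 / p₀) - 2 * ‖e m‖ ^ 2) := by
  classical
  have h1 := (((lp_hasSum_norm_sq e).mul_left 2).add
    (((lp_hasSum_norm_sq e).add (lp_hasSum_norm_sq f)).mul_left (4 * t ^ s))).add
    (hasSum_sum_of_ne_finset_zero (s := S) (f := fun m => if m ∈ S then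
      (2 * (‖e m‖ ^ p₀ + (t * ‖f m‖) ^ p₀) ^ (2 / p₀) - 2 * ‖e m‖ ^ 2) else 0)
      fun m hm => if_neg hm)
  have e1 : ∑ m ∈ S, (if m ∈ S then
      (2 * (‖e m‖ ^ p₀ + (t * ‖f m‖) ^ p₀) ^ (2 / p₀) - 2 * ‖e m‖ ^ 2) else 0) =
      ∑ m ∈ S, (2 * (‖e m‖ ^ p₀ + (t * ‖f m‖) ^ p₀) ^ (2 / p₀) - 2 * ‖e m‖ ^ 2) :=
    Finset.sum_congr rfl fun m hm => if_pos hm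
  rw [e1] at h1
  refine hasSum_le (fun m => ?_) (lp_hasSum_add_sub e ((t : 𝕜) • f)) h1
  have hft : ((t : 𝕜) • f) m = (t : 𝕜) • f m := rfl
  have hpos : 0 ≤ 4 * t ^ s * (‖e m‖ ^ 2 + ‖f m‖ ^ 2) := by positivity
  have h2 := hG m (e m) ((t : 𝕜) • f m)
  rw [norm_ofReal_smul ht0.le] at h2
  rw [hft]
  -- Exponent `p₀` keeps its exact bound, smaller exponents carry no `f`, and the remaining ones are
  -- at least `s`.
  by_cases hm : m ∈ S
  · rw [if_pos hm]
    rw [(hS m).1 hm] at h2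
    linarith
  · rw [if_neg hm]
    have hne : p m ≠ p₀ := fun h => hm ((hS m).2 h)
    rcases hps m with hlt | hle
    · have hz := hf m (lt_of_le_of_ne hlt hne)
      have h0 : 0 < p m := by linarith [hp1 m]
      rw [hz] at hpos ⊢
      rw [hz, norm_zero, mul_zero, Real.zero_rpow h0.ne', add_zero,
        rpow_rpow_two_div (norm_nonneg _) h0] at h2
      linarith
    · have h3 := sq_rpow_add_le (norm_nonneg (e m)) (mul_nonneg ht0.le (norm_nonneg (f m)))
        (by linarith : 0 < s) hle
      have h4 := sq_rpow_add_mul_le (norm_nonneg (e m)) (norm_nonneg (f m)) (hp₀.trans hs) hs2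
        ht0.le ht1
      linarith

/-- Upper quadratic expansion in the `ℓ₂`-sum of uniformly 2-smooth spaces. -/
lemma lp_norm_sq_add_sub_le_of_smooth {C : ℝ}
    (hG : ∀ n, ∀ x y : G n, ‖x + y‖ ^ 2 + ‖x - y‖ ^ 2 ≤ 2 * (‖x‖ ^ 2 + (C * ‖y‖) ^ 2))
    (e f : lp G 2) :
    ‖e + f‖ ^ 2 + ‖e - f‖ ^ 2 ≤ 2 * (‖e‖ ^ 2 + C ^ 2 * ‖f‖ ^ 2) :=
  hasSum_le (fun m => by rw [← mul_pow]; exact hG m (e m) (f m)) (lp_hasSum_add_sub e f)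
    (((lp_hasSum_norm_sq e).add ((lp_hasSum_norm_sq f).mul_left (C ^ 2))).mul_left 2)

/-- Lower expansion in the `ℓ₂`-sum of spaces satisfying the `q`-inequalities. -/
lemma le_lp_norm_sq_add_sub {q : ℕ → ℝ} (hq : ∀ n, 2 < q n)
    (hG : ∀ n, ∀ x y : G n,
      2 * (‖x‖ ^ q n + ‖y‖ ^ q n) ^ (2 / q n) ≤ ‖x + y‖ ^ 2 + ‖x - y‖ ^ 2)
    (e f : lp G 2) (m : ℕ) :
    2 * ‖e‖ ^ 2 + (2 * (‖e m‖ ^ q m + ‖f m‖ ^ q m) ^ (2 / q m) - 2 * ‖e m‖ ^ 2) ≤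
      ‖e + f‖ ^ 2 + ‖e - f‖ ^ 2 := by
  classical
  have h1 := ((lp_hasSum_norm_sq e).mul_left 2).add
    (hasSum_ite_eq m (2 * (‖e m‖ ^ q m + ‖f m‖ ^ q m) ^ (2 / q m) - 2 * ‖e m‖ ^ 2))
  refine hasSum_le (fun k => ?_) h1 (lp_hasSum_add_sub e f)
  have h2 := hG k (e k) (f k)
  split_ifs with hk
  · subst hk
    linarith
  · have h0 : 0 < q k := by linarith [hq k]
    have h3 : (‖e k‖ ^ q k) ^ (2 / q k) ≤ (‖e k‖ ^ q k + ‖f k‖ ^ q k) ^ (2 / q k) :=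
      Real.rpow_le_rpow (by positivity) (le_add_of_nonneg_right (by positivity)) (by positivity)
    rw [rpow_rpow_two_div (norm_nonneg _) h0] at h3
    linarith

end Expansions

section Rigidity

variable {𝕜 : Type*} [RCLike 𝕜] {E F : ℕ → Type u}
  [∀ n, NormedAddCommGroup (E n)] [∀ n, NormedSpace 𝕜 (E n)]
  [∀ n, NormedAddCommGroup (F n)] [∀ n, NormedSpace 𝕜 (F n)]
  {H : Type v} [NormedAddCommGroup H] [InnerProductSpace 𝕜 H]

/-- The second summand of a 2-sum. -/
def twoSumInr (𝕜 : Type*) [RCLike 𝕜] (X H : Type*) [NormedAddCommGroup X] [NormedSpace 𝕜 X]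
    [NormedAddCommGroup H] [NormedSpace 𝕜 H] : H →ₗᵢ[𝕜] TwoSum X H where
  toLinearMap := (WithLp.linearEquiv 2 𝕜 (X × H)).symm.toLinearMap ∘ₗ LinearMap.inr 𝕜 X H
  norm_map' x := WithLp.norm_toLp_snd 2 X H x

lemma norm_sq_twoSum₃ {X Y Z : Type*} [NormedAddCommGroup X] [NormedAddCommGroup Y]
    [NormedAddCommGroup Z] (w : TwoSum (TwoSum X Y) Z) :
    ‖w‖ ^ 2 = ‖w.fst.fst‖ ^ 2 + ‖w.fst.snd‖ ^ 2 + ‖w.snd‖ ^ 2 := by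
  rw [WithLp.prod_norm_sq_eq_of_L2, WithLp.prod_norm_sq_eq_of_L2]

/-- An `ℓ_{p₀}`-pair, with `y` vanishing on the coordinates of smaller exponent, has `y` supported
on the coordinates of exponent `p₀`. -/
lemma IsLpPair.one_le_sum {p : ℕ → ℝ} (hp1 : ∀ n, 1 ≤ p n)
    (hE : ∀ n, ∀ x y : E n,
      ‖x + y‖ ^ 2 + ‖x - y‖ ^ 2 ≤ 2 * (‖x‖ ^ p n + ‖y‖ ^ p n) ^ (2 / p n))
    {C : ℝ} (hF : ∀ n, ∀ x y : F n, ‖x + y‖ ^ 2 + ‖x - y‖ ^ 2 ≤ 2 * (‖x‖ ^ 2 + (C * ‖y‖) ^ 2))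
    {p₀ s : ℝ} (hp₀ : 1 ≤ p₀) (hp₀2 : p₀ < 2) (hs : p₀ < s) (hs2 : s ≤ 2) (S : Finset ℕ)
    (hS : ∀ m, m ∈ S ↔ p m = p₀) (hps : ∀ m, p m ≤ p₀ ∨ s ≤ p m)
    {x y : TwoSum (TwoSum (lp E 2) (lp F 2)) H} (hxy : IsLpPair 𝕜 p₀ x y)
    (hy : ∀ m, p m < p₀ → y.fst.fst m = 0) : 1 ≤ ∑ m ∈ S, ‖y.fst.fst m‖ ^ 2 := by
  have hp₀0 : 0 < p₀ := by linarith
  have hx1 := hxy.norm_left hp₀0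
  have hy1 := hxy.norm_right hp₀0
  have hxn := norm_sq_twoSum₃ x
  have hyn := norm_sq_twoSum₃ y
  rw [hx1, one_pow] at hxn
  rw [hy1, one_pow] at hyn
  have hA1 : ∑ m ∈ S, ‖x.fst.fst m‖ ^ 2 ≤ 1 := by
    have := lp_norm_sq_sub_sum x.fst.fst S
    nlinarith [sq_nonneg ‖x.fst.fst - ∑ n ∈ S, lp.single 2 n (x.fst.fst n)‖,
      sq_nonneg ‖x.fst.snd‖, sq_nonneg ‖x.snd‖]
  -- After halving, the terms of order t^s have coefficient 4 from E, C² from F and 1 from H.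
  refine one_le_of_rpow_expansion (K := 5 + C ^ 2) hp₀0 hp₀2 hs
    (Finset.sum_nonneg fun m _ => sq_nonneg _) hA1 (Finset.sum_nonneg fun m _ => sq_nonneg _)
    fun t ht0 ht1 => ?_
  have h1 := hxy.norm_sq_add_norm_sq_sub hp₀0 ht0.le
  rw [norm_sq_twoSum₃, norm_sq_twoSum₃] at h1
  have h2 := lp_norm_sq_add_sub_le (𝕜 := 𝕜) hp1 hE hp₀ hs.le hs2 S hS hps
    (e := x.fst.fst) hy ht0 ht1
  have h3 := lp_norm_sq_add_sub_le_of_smooth hF x.fst.snd ((t : 𝕜) • y.fst.snd)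
  have h4 := parallelogram_law_with_norm 𝕜 x.snd ((t : 𝕜) • y.snd)
  rw [norm_ofReal_smul ht0.le] at h3 h4
  have h5 := sum_sq_rpow_add_le S (fun m => ‖x.fst.fst m‖) (fun m => ‖y.fst.fst m‖)
    (fun _ => norm_nonneg _) (fun _ => norm_nonneg _) hp₀0 hp₀2.le ht0.le
  have hts : t ^ 2 ≤ t ^ s := by
    rw [← Real.rpow_two]
    exact Real.rpow_le_rpow_of_exponent_ge ht0 ht1 hs2
  have hts0 : 0 ≤ t ^ s := by positivity
  rw [Finset.sum_sub_distrib, ← Finset.mul_sum, ← Finset.mul_sum] at h2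
  change (‖x.fst.fst + (t : 𝕜) • y.fst.fst‖ ^ 2 + ‖x.fst.snd + (t : 𝕜) • y.fst.snd‖ ^ 2 +
    ‖x.snd + (t : 𝕜) • y.snd‖ ^ 2) + (‖x.fst.fst - (t : 𝕜) • y.fst.fst‖ ^ 2 +
    ‖x.fst.snd - (t : 𝕜) • y.fst.snd‖ ^ 2 + ‖x.snd - (t : 𝕜) • y.snd‖ ^ 2) = _ at h1
  have b1 : ‖x.fst.fst‖ ^ 2 + ‖y.fst.fst‖ ^ 2 ≤ 2 := by
    linarith [sq_nonneg ‖x.fst.snd‖, sq_nonneg ‖x.snd‖, sq_nonneg ‖y.fst.snd‖, sq_nonneg ‖y.snd‖]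
  have b2 : ‖y.fst.snd‖ ^ 2 ≤ 1 := by
    linarith [sq_nonneg ‖y.fst.fst‖, sq_nonneg ‖y.snd‖]
  have b3 : ‖y.snd‖ ^ 2 ≤ 1 := by
    linarith [sq_nonneg ‖y.fst.fst‖, sq_nonneg ‖y.fst.snd‖]
  have c1 : 4 * t ^ s * (‖x.fst.fst‖ ^ 2 + ‖y.fst.fst‖ ^ 2) ≤ 4 * t ^ s * 2 := by gcongr
  have c2 : C ^ 2 * (t * ‖y.fst.snd‖) ^ 2 ≤ C ^ 2 * t ^ s := by
    rw [mul_pow]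
    have : t ^ 2 * ‖y.fst.snd‖ ^ 2 ≤ t ^ s * 1 := mul_le_mul hts b2 (sq_nonneg _) hts0
    rw [mul_one] at this
    gcongr
  have c3 : (t * ‖y.snd‖) ^ 2 ≤ t ^ s := by
    rw [mul_pow]
    have : t ^ 2 * ‖y.snd‖ ^ 2 ≤ t ^ s * 1 := mul_le_mul hts b3 (sq_nonneg _) hts0
    rwa [mul_one] at this
  linarith

/-- An `ℓ_{q₀}`-pair, with `y` vanishing on `E`, has `y` supported on the coordinates of `F` of
exponent at least `q₀`. -/
lemma IsLpPair.eq_zero_of_lt {q : ℕ → ℝ} (hq : ∀ n, 2 < q n)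
    (hF : ∀ n, ∀ x y : F n,
      2 * (‖x‖ ^ q n + ‖y‖ ^ q n) ^ (2 / q n) ≤ ‖x + y‖ ^ 2 + ‖x - y‖ ^ 2)
    {q₀ : ℝ} (hq₀ : 2 < q₀) {x y : TwoSum (TwoSum (lp E 2) (lp F 2)) H}
    (hxy : IsLpPair 𝕜 q₀ x y) (hy : y.fst.fst = 0) :
    (∀ m, q m < q₀ → y.fst.snd m = 0) ∧ y.snd = 0 := by
  have hq₀0 : 0 < q₀ := by linarith
  have hx1 := hxy.norm_left hq₀0
  have hy1 := hxy.norm_right hq₀0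
  have hxn := norm_sq_twoSum₃ x
  have hyn := norm_sq_twoSum₃ y
  rw [hx1, one_pow] at hxn
  rw [hy1, one_pow] at hyn
  have key : ∀ t : ℝ, 0 < t → ∀ m, 1 + ((‖x.fst.snd m‖ ^ q m + (t * ‖y.fst.snd m‖) ^ q m) ^
      (2 / q m) - ‖x.fst.snd m‖ ^ 2) + (t * ‖y.snd‖) ^ 2 ≤ (1 + t ^ q₀) ^ (2 / q₀) := by
    intro t ht0 m
    have h1 := hxy.norm_sq_add_norm_sq_sub hq₀0 ht0.le
    rw [norm_sq_twoSum₃, norm_sq_twoSum₃] at h1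
    have h2 := le_lp_norm_sq_add_sub hq hF x.fst.snd ((t : 𝕜) • y.fst.snd) m
    have h4 := parallelogram_law_with_norm 𝕜 x.snd ((t : 𝕜) • y.snd)
    rw [lp.coeFn_smul, Pi.smul_apply] at h2
    rw [norm_ofReal_smul ht0.le] at h2 h4
    change (‖x.fst.fst + (t : 𝕜) • y.fst.fst‖ ^ 2 + ‖x.fst.snd + (t : 𝕜) • y.fst.snd‖ ^ 2 +
      ‖x.snd + (t : 𝕜) • y.snd‖ ^ 2) + (‖x.fst.fst - (t : 𝕜) • y.fst.fst‖ ^ 2 +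
      ‖x.fst.snd - (t : 𝕜) • y.fst.snd‖ ^ 2 + ‖x.snd - (t : 𝕜) • y.snd‖ ^ 2) = _ at h1
    rw [hy, smul_zero, add_zero, sub_zero] at h1
    linarith
  constructor
  · intro m hm
    have hx2 : ‖x.fst.snd m‖ ≤ 1 := by
      have := lp_norm_sq_sub_single x.fst.snd m
      have : ‖x.fst.snd m‖ ^ 2 ≤ 1 := by
        nlinarith [sq_nonneg ‖x.fst.snd - lp.single 2 m (x.fst.snd m)‖, sq_nonneg ‖x.fst.fst‖,
          sq_nonneg ‖x.snd‖]
      exact (sq_le_one_iff₀ (norm_nonneg _)).1 this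
    have hy2 : ‖y.fst.snd m‖ ≤ 1 := by
      have := lp_norm_sq_sub_single y.fst.snd m
      have : ‖y.fst.snd m‖ ^ 2 ≤ 1 := by
        nlinarith [sq_nonneg ‖y.fst.snd - lp.single 2 m (y.fst.snd m)‖, sq_nonneg ‖y.fst.fst‖,
          sq_nonneg ‖y.snd‖]
      exact (sq_le_one_iff₀ (norm_nonneg _)).1 this
    refine norm_eq_zero.1 (eq_zero_of_rpow_expansion (hq m).le hm (norm_nonneg _) hx2
      (norm_nonneg _) hy2 fun t ht0 _ => ?_)
    linarith [key t ht0 m, sq_nonneg (t * ‖y.snd‖)]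
  · have hy2 : ‖y.snd‖ ^ 2 ≤ 1 := by
      linarith [sq_nonneg ‖y.fst.fst‖, sq_nonneg ‖y.fst.snd‖]
    rw [sq_le_one_iff₀ (norm_nonneg _)] at hy2
    -- The Hilbert summand acts as a coordinate of exponent 2. In `key` the coordinate 0 is an
    -- arbitrary choice, since the bracket is nonnegative for any.
    refine norm_eq_zero.1 (eq_zero_of_rpow_expansion (a := 0) le_rfl hq₀ le_rfl zero_le_one
      (norm_nonneg _) hy2 fun t ht0 _ => ?_)
    have h0 : 0 < q 0 := by linarith [hq 0]
    have h1 := key t ht0 0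
    have h3 : (‖x.fst.snd 0‖ ^ q 0) ^ (2 / q 0) ≤
        (‖x.fst.snd 0‖ ^ q 0 + (t * ‖y.fst.snd 0‖) ^ q 0) ^ (2 / q 0) :=
      Real.rpow_le_rpow (by positivity) (le_add_of_nonneg_right (by positivity)) (by positivity)
    rw [rpow_rpow_two_div (norm_nonneg _) h0] at h3
    rw [Real.zero_rpow two_ne_zero, zero_add, rpow_rpow_two_div (by positivity) two_pos]
    linarith

end Rigidity

end

/-! ### Rigidity of E, then of F. -/

noncomputable section

section Rigidity

/-- Values of a sequence increasing to its limit do not accumulate from the right below it. -/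
lemma exists_gap_of_tendsto {c : ℕ → ℝ} {l a : ℝ} (hc : Tendsto c atTop (𝓝 l)) (ha : a < l) :
    ∃ s, a < s ∧ s ≤ l ∧ ∀ m, c m ≤ a ∨ s ≤ c m := by
  classical
  have hfin := finite_setOf_le_of_tendsto hc (show (a + l) / 2 < l by linarith)
  -- Finitely many values lie below the midpoint; the least one above `a`, or the midpoint itself,
  -- bounds the gap.
  let A := (insert ((a + l) / 2) (hfin.toFinset.image c)).filter (a < ·)
  have hmid : (a + l) / 2 ∈ A := by
    simp only [A, Finset.mem_filter, Finset.mem_insert, true_or, true_and]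
    linarith
  have hs := A.min'_mem ⟨_, hmid⟩
  refine ⟨A.min' ⟨_, hmid⟩, (Finset.mem_filter.1 hs).2,
    (A.min'_le _ hmid).trans (by linarith), fun m => ?_⟩
  rw [or_iff_not_imp_left, not_le]
  intro hm
  rcases le_total (c m) ((a + l) / 2) with h | h
  · refine A.min'_le _ (Finset.mem_filter.2 ⟨Finset.mem_insert_of_mem ?_, hm⟩)
    exact Finset.mem_image_of_mem c (hfin.mem_toFinset.2 h)
  · exact (A.min'_le _ hmid).trans h

variable {𝕜 : Type*} [RCLike 𝕜]

/-- The inclusion of a coordinate in the `ℓ₂`-sum. -/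
def lpSingleₗᵢ (𝕜 : Type*) [RCLike 𝕜] {G : ℕ → Type*} [∀ n, NormedAddCommGroup (G n)]
    [∀ n, NormedSpace 𝕜 (G n)] (n : ℕ) : G n →ₗᵢ[𝕜] lp G 2 where
  toLinearMap := lp.lsingle 2 n
  norm_map' x := lp.norm_single (by norm_num) n x

variable {E F : ℕ → Type u}
  [∀ n, NormedAddCommGroup (E n)] [∀ n, NormedSpace 𝕜 (E n)]
  [∀ n, NormedAddCommGroup (F n)] [∀ n, NormedSpace 𝕜 (F n)]
  {H : Type v} [NormedAddCommGroup H] [InnerProductSpace 𝕜 H]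

/-- The embedding of `E` in `E ⊕₂ F ⊕₂ H`. -/
def inclFst (𝕜 : Type*) [RCLike 𝕜] (X Y H : Type*) [NormedAddCommGroup X] [NormedSpace 𝕜 X]
    [NormedAddCommGroup Y] [NormedSpace 𝕜 Y] [NormedAddCommGroup H] [NormedSpace 𝕜 H] :
    X →ₗᵢ[𝕜] TwoSum (TwoSum X Y) H := (twoSumInl 𝕜 (TwoSum X Y) H).comp (twoSumInl 𝕜 X Y)

/-- The embedding of `F` in `E ⊕₂ F ⊕₂ H`. -/
def inclSnd (𝕜 : Type*) [RCLike 𝕜] (X Y H : Type*) [NormedAddCommGroup X] [NormedSpace 𝕜 X]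
    [NormedAddCommGroup Y] [NormedSpace 𝕜 Y] [NormedAddCommGroup H] [NormedSpace 𝕜 H] :
    Y →ₗᵢ[𝕜] TwoSum (TwoSum X Y) H := (twoSumInl 𝕜 (TwoSum X Y) H).comp (twoSumInr 𝕜 X Y)

lemma norm_sq_add_inclFst {X Y H : Type*} [NormedAddCommGroup X] [NormedSpace 𝕜 X]
    [NormedAddCommGroup Y] [NormedSpace 𝕜 Y] [NormedAddCommGroup H] [NormedSpace 𝕜 H]
    (w : TwoSum (TwoSum X Y) H) (x : X) :
    ‖w + inclFst 𝕜 X Y H x‖ ^ 2 = ‖w.fst.fst + x‖ ^ 2 + ‖w.fst.snd‖ ^ 2 + ‖w.snd‖ ^ 2 := by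
  rw [norm_sq_twoSum₃]
  change ‖w.fst.fst + x‖ ^ 2 + ‖w.fst.snd + 0‖ ^ 2 + ‖w.snd + 0‖ ^ 2 = _
  rw [add_zero, add_zero]

lemma norm_sq_add_inclSnd {X Y H : Type*} [NormedAddCommGroup X] [NormedSpace 𝕜 X]
    [NormedAddCommGroup Y] [NormedSpace 𝕜 Y] [NormedAddCommGroup H] [NormedSpace 𝕜 H]
    (w : TwoSum (TwoSum X Y) H) (y : Y) :
    ‖w + inclSnd 𝕜 X Y H y‖ ^ 2 = ‖w.fst.fst‖ ^ 2 + ‖w.fst.snd + y‖ ^ 2 + ‖w.snd‖ ^ 2 := by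
  rw [norm_sq_twoSum₃]
  change ‖w.fst.fst + 0‖ ^ 2 + ‖w.fst.snd + y‖ ^ 2 + ‖w.snd + 0‖ ^ 2 = _
  rw [add_zero, add_zero]

/-- An isometric embedding of `E ⊕₂ F` in `E ⊕₂ F ⊕₂ H` maps `E` onto `E`. -/
theorem range_fst_eq [∀ n, FiniteDimensional 𝕜 (E n)] {p : ℕ → ℝ} (hp1 : ∀ n, 1 ≤ p n)
    (hp2 : ∀ n, p n < 2) (hp : Tendsto p atTop (𝓝 2))
    (hEa : ∀ n, ∀ x y : E n,
      ‖x + y‖ ^ 2 + ‖x - y‖ ^ 2 ≤ 2 * (‖x‖ ^ p n + ‖y‖ ^ p n) ^ (2 / p n))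
    (hEb : ∀ n, HasLpPairBasis 𝕜 (E n) (p n)) {C : ℝ}
    (hF : ∀ n, ∀ x y : F n, ‖x + y‖ ^ 2 + ‖x - y‖ ^ 2 ≤ 2 * (‖x‖ ^ 2 + (C * ‖y‖) ^ 2))
    (T : TwoSum (lp E 2) (lp F 2) →ₗᵢ[𝕜] TwoSum (TwoSum (lp E 2) (lp F 2)) H) :
    Set.range (T.comp (twoSumInl 𝕜 (lp E 2) (lp F 2))) =
      Set.range (inclFst 𝕜 (lp E 2) (lp F 2) H) := by
  set S := T.comp (twoSumInl 𝕜 (lp E 2) (lp F 2)) with hS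
  set J := inclFst 𝕜 (lp E 2) (lp F 2) H with hJ
  refine range_eq_of_level_step hp hp2 fun n ih => ?_
  obtain ⟨d, b, hb⟩ := hEb n
  refine ⟨d, b, fun j => ?_⟩
  obtain ⟨i, hij⟩ := hb j
  have hpn : 0 < p n := by linarith [hp1 n]
  obtain ⟨s, hs, hs2, hps⟩ := exists_gap_of_tendsto hp (hp2 n)
  have hfin : {m | p m = p n}.Finite :=
    (finite_setOf_le_of_tendsto hp (hp2 n)).subset fun m hm => le_of_eq hm
  have hpair : IsLpPair 𝕜 (p n) (S (lp.single 2 n (b i))) (S (lp.single 2 n (b j))) :=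
    (hij.map (lpSingleₗᵢ 𝕜 n)).map S
  have hnv := hpair.norm_right hpn
  -- By induction the component of the image at m is itself some `S a`, with a orthogonal to the
  -- given basis vector. Adding `S a` therefore increases the squared norm by ‖a‖², but it also
  -- doubles that component, which costs 3‖a‖²; so a = 0.
  have hz : ∀ m, p m < p n → (S (lp.single 2 n (b j))).fst.fst m = 0 := by
    intro m hm
    obtain ⟨a, ha, hae⟩ : J (lp.single 2 m ((S (lp.single 2 n (b j))).fst.fst m)) ∈
        (lpLevel 𝕜 E p m).map S.toLinearMap := by
      rw [ih m hm]
      exact Submodule.mem_map_of_mem (single_mem_lpLevel rfl _)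
    have hae : S a = J (lp.single 2 m ((S (lp.single 2 n (b j))).fst.fst m)) := hae
    have h1 := norm_sq_add_inclFst (𝕜 := 𝕜) (S (lp.single 2 n (b j)))
      (lp.single 2 m ((S (lp.single 2 n (b j))).fst.fst m))
    rw [lp_norm_add_single_self (𝕜 := 𝕜), ← hJ, ← hae, ← map_add, S.norm_map,
      lp_norm_single_add n (b j) a (ha n hm.ne')] at h1
    have h2 := norm_sq_twoSum₃ (S (lp.single 2 n (b j)))
    have h3 : ‖a‖ = ‖(S (lp.single 2 n (b j))).fst.fst m‖ := by
      rw [← S.norm_map, hae, J.norm_map, lp.norm_single (by norm_num)]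
    have h4 : ‖S (lp.single 2 n (b j))‖ = ‖b j‖ := by
      rw [S.norm_map, lp.norm_single (by norm_num)]
    rw [h4] at h2
    rw [h3] at h1
    have h5 : ‖(S (lp.single 2 n (b j))).fst.fst m‖ ^ 2 = 0 := by linarith
    exact norm_eq_zero.1 (pow_eq_zero_iff two_ne_zero |>.1 h5)
  -- The level of `p n` carries squared norm at least 1, which is all of the squared norm of the
  -- image.
  have hone := hpair.one_le_sum hp1 hEa hF (hp1 n) (hp2 n) hs hs2 hfin.toFinset
    (fun m => by simp) hps hz
  generalize S (lp.single 2 n (b j)) = v at *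
  refine ⟨∑ m ∈ hfin.toFinset, lp.single 2 m (v.fst.fst m), Submodule.sum_mem _ fun m hm =>
    single_mem_lpLevel (hfin.mem_toFinset.1 hm) _, ?_⟩
  have h1 := norm_sq_add_inclFst (𝕜 := 𝕜) v
    (-∑ m ∈ hfin.toFinset, lp.single 2 m (v.fst.fst m))
  rw [map_neg, ← sub_eq_add_neg, ← sub_eq_add_neg, lp_norm_sq_sub_sum] at h1
  have h2 := norm_sq_twoSum₃ v
  rw [hnv] at h2
  have h3 : ‖v - J (∑ m ∈ hfin.toFinset, lp.single 2 m (v.fst.fst m))‖ ^ 2 ≤ 0 := by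
    rw [h1]; linarith
  have h4 := pow_eq_zero_iff two_ne_zero |>.1 (le_antisymm h3 (sq_nonneg _))
  exact (sub_eq_zero.1 (norm_eq_zero.1 h4)).symm

/-- An isometric embedding of `E ⊕₂ F` in `E ⊕₂ F ⊕₂ H` that maps `E` onto `E` maps `F` onto
`F`. -/
theorem range_snd_eq [∀ n, FiniteDimensional 𝕜 (F n)] {q : ℕ → ℝ}
    (hq2 : ∀ n, 2 < q n) (hq : Tendsto q atTop (𝓝 2))
    (hFa : ∀ n, ∀ x y : F n,
      2 * (‖x‖ ^ q n + ‖y‖ ^ q n) ^ (2 / q n) ≤ ‖x + y‖ ^ 2 + ‖x - y‖ ^ 2)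
    (hFb : ∀ n, HasLpPairBasis 𝕜 (F n) (q n))
    (T : TwoSum (lp E 2) (lp F 2) →ₗᵢ[𝕜] TwoSum (TwoSum (lp E 2) (lp F 2)) H)
    (hT : Set.range (T.comp (twoSumInl 𝕜 (lp E 2) (lp F 2))) =
      Set.range (inclFst 𝕜 (lp E 2) (lp F 2) H)) :
    Set.range (T.comp (twoSumInr 𝕜 (lp E 2) (lp F 2))) =
      Set.range (inclSnd 𝕜 (lp E 2) (lp F 2) H) := by
  set S := T.comp (twoSumInr 𝕜 (lp E 2) (lp F 2)) with hS
  set J := inclSnd 𝕜 (lp E 2) (lp F 2) H with hJ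
  -- The sign makes the induction start from the largest exponents.
  refine range_eq_of_level_step (c := fun n => -q n) hq.neg (fun n => neg_lt_neg (hq2 n))
    fun n ih => ?_
  obtain ⟨d, b, hb⟩ := hFb n
  refine ⟨d, b, fun j => ?_⟩
  obtain ⟨i, hij⟩ := hb j
  have hpair : IsLpPair 𝕜 (q n) (S (lp.single 2 n (b i))) (S (lp.single 2 n (b j))) :=
    (hij.map (lpSingleₗᵢ 𝕜 n)).map S
  have h4 : ‖S (lp.single 2 n (b j))‖ = ‖b j‖ := by
    rw [S.norm_map, lp.norm_single (by norm_num)]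
  have hz : ∀ m, -q m < -q n → (S (lp.single 2 n (b j))).fst.snd m = 0 := by
    intro m hm
    obtain ⟨a, ha, hae⟩ : J (lp.single 2 m ((S (lp.single 2 n (b j))).fst.snd m)) ∈
        (lpLevel 𝕜 F (fun n => -q n) m).map S.toLinearMap := by
      rw [ih m hm]
      exact Submodule.mem_map_of_mem (single_mem_lpLevel rfl _)
    have hae : S a = J (lp.single 2 m ((S (lp.single 2 n (b j))).fst.snd m)) := hae
    have h1 := norm_sq_add_inclSnd (𝕜 := 𝕜) (S (lp.single 2 n (b j)))
      (lp.single 2 m ((S (lp.single 2 n (b j))).fst.snd m))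
    rw [lp_norm_add_single_self (𝕜 := 𝕜), ← hJ, ← hae, ← map_add, S.norm_map,
      lp_norm_single_add n (b j) a (ha n hm.ne')] at h1
    have h2 := norm_sq_twoSum₃ (S (lp.single 2 n (b j)))
    have h3 : ‖a‖ = ‖(S (lp.single 2 n (b j))).fst.snd m‖ := by
      rw [← S.norm_map, hae, J.norm_map, lp.norm_single (by norm_num)]
    rw [h4] at h2
    rw [h3] at h1
    have h5 : ‖(S (lp.single 2 n (b j))).fst.snd m‖ ^ 2 = 0 := by linarith
    exact norm_eq_zero.1 (pow_eq_zero_iff two_ne_zero |>.1 h5)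
  -- The doubling argument again, with the whole of E as the summand already filled.
  have hE : (S (lp.single 2 n (b j))).fst.fst = 0 := by
    obtain ⟨a, ha⟩ : inclFst 𝕜 (lp E 2) (lp F 2) H (S (lp.single 2 n (b j))).fst.fst ∈
        Set.range (T.comp (twoSumInl 𝕜 (lp E 2) (lp F 2))) := by
      rw [hT]
      exact ⟨_, rfl⟩
    have h1 := norm_sq_add_inclFst (𝕜 := 𝕜) (S (lp.single 2 n (b j)))
      (S (lp.single 2 n (b j))).fst.fst
    have h3 : ‖a‖ = ‖(S (lp.single 2 n (b j))).fst.fst‖ := by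
      rw [← LinearIsometry.norm_map (T.comp (twoSumInl 𝕜 (lp E 2) (lp F 2))), ha,
        LinearIsometry.norm_map]
    have h5 : S (lp.single 2 n (b j)) + T.comp (twoSumInl 𝕜 (lp E 2) (lp F 2)) a =
        T (WithLp.toLp 2 (a, lp.single 2 n (b j))) := by
      rw [hS]
      change T _ + T _ = _
      rw [← map_add]
      congr 1
      change WithLp.toLp 2 ((0 : lp E 2), lp.single 2 n (b j)) + WithLp.toLp 2 (a, (0 : lp F 2)) = _
      rw [← WithLp.toLp_add, Prod.mk_add_mk, zero_add, add_zero]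
    rw [norm_two_smul_sq (𝕜 := 𝕜), ← ha, h5, T.norm_map, WithLp.prod_norm_sq_eq_of_L2] at h1
    change ‖a‖ ^ 2 + ‖lp.single 2 n (b j)‖ ^ 2 = _ at h1
    rw [h3, lp.norm_single (by norm_num)] at h1
    have h2 := norm_sq_twoSum₃ (S (lp.single 2 n (b j)))
    rw [h4] at h2
    have h6 : ‖(S (lp.single 2 n (b j))).fst.fst‖ ^ 2 = 0 := by linarith
    exact norm_eq_zero.1 (pow_eq_zero_iff two_ne_zero |>.1 h6)
  obtain ⟨hlt, hH⟩ := hpair.eq_zero_of_lt hq2 hFa (hq2 n) hE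
  generalize S (lp.single 2 n (b j)) = v at *
  refine ⟨v.fst.snd, fun m hm => ?_, ?_⟩
  · rcases lt_or_gt_of_ne hm with h | h
    · exact hz m h
    · exact hlt m (neg_lt_neg_iff.1 h)
  · change WithLp.toLp 2 (WithLp.toLp 2 (0, v.fst.snd), 0) = v
    rw [← hE, ← hH]
    rfl

end Rigidity

end

/-! ### Truncations, and the asymptotic parallelogram law. -/

noncomputable section

section Truncation

variable {𝕜 : Type*} [RCLike 𝕜] {G : ℕ → Type*} [∀ n, NormedAddCommGroup (G n)]
  [∀ n, NormedSpace 𝕜 (G n)]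

/-- Truncation to the first `N` coordinates. -/
def lpTrunc (𝕜 : Type*) [RCLike 𝕜] (G : ℕ → Type*) [∀ n, NormedAddCommGroup (G n)]
    [∀ n, NormedSpace 𝕜 (G n)] (N : ℕ) : lp G 2 →ₗ[𝕜] lp G 2 :=
  ∑ n ∈ Finset.range N, lp.lsingle 2 n ∘ₗ lp.evalₗ (𝕜 := 𝕜) (E := G) 2 n

lemma lpTrunc_apply (N : ℕ) (f : lp G 2) :
    lpTrunc 𝕜 G N f = ∑ n ∈ Finset.range N, lp.single 2 n (f n) := by
  rw [lpTrunc, LinearMap.sum_apply]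
  rfl

lemma lp_norm_sq_trunc (N : ℕ) (f : lp G 2) :
    ‖f‖ ^ 2 = ‖lpTrunc 𝕜 G N f‖ ^ 2 + ‖f - lpTrunc 𝕜 G N f‖ ^ 2 := by
  have h := lp.norm_sum_single (p := 2) (by norm_num) f (Finset.range N)
  have h' : ‖∑ n ∈ Finset.range N, lp.single 2 n (f n)‖ ^ 2 =
    ∑ n ∈ Finset.range N, ‖f n‖ ^ 2 := by simpa using h
  rw [lpTrunc_apply, lp_norm_sq_sub_sum, h']
  ring

lemma tendsto_lpTrunc (f : lp G 2) : Tendsto (fun N => lpTrunc 𝕜 G N f) atTop (𝓝 f) := by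
  simp only [lpTrunc_apply]
  exact tendsto_sum_single f

lemma sub_lpTrunc_apply {N m : ℕ} (hm : m < N) (f : lp G 2) :
    (f - lpTrunc 𝕜 G N f : lp G 2) m = 0 := by
  rw [lpTrunc_apply, lp.coeFn_sub, Pi.sub_apply, lp.coeFn_sum, Finset.sum_apply,
    Finset.sum_eq_single_of_mem m (Finset.mem_range.2 hm) fun k _ hk =>
      lp.single_apply_ne _ _ _ hk.symm, lp.single_apply_self, sub_self]

lemma exists_lp_limit [∀ n, FiniteDimensional 𝕜 (G n)] {I : Type*} (U : Ultrafilter I)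
    (x : I → lp G 2) (C : ℝ) (hx : ∀ i, ‖x i‖ ≤ C) :
    ∃ l, ∀ N, Tendsto (fun i => lpTrunc 𝕜 G N (x i)) (U : Filter I) (𝓝 (lpTrunc 𝕜 G N l)) := by
  have hbdd : Bornology.IsBounded (Set.range x) :=
    isBounded_iff_forall_norm_le.2 ⟨C, by rintro _ ⟨i, rfl⟩; exact hx i⟩
  have hex : ∀ n, ∃ l, Tendsto (fun i => x i n) (U : Filter I) (𝓝 l) := fun n => by
    have := FiniteDimensional.proper 𝕜 (G n)
    refine Ultrapower.exists_tendsto_of_bounded (isBounded_iff_forall_norm_le.2 ⟨C, ?_⟩) U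
    rintro _ ⟨i, rfl⟩
    exact (lp.norm_apply_le_norm (by norm_num) (x i) n).trans (hx i)
  choose l hl using hex
  -- The coordinatewise limit of a bounded family stays in ℓ₂, by Fatou.
  have hmem : Memℓp l 2 := lp.memℓp_of_tendsto hbdd (tendsto_pi_nhds.2 hl)
  refine ⟨⟨l, hmem⟩, fun N => ?_⟩
  simp only [lpTrunc_apply]
  refine tendsto_finsetSum _ fun n _ => ?_
  exact ((lpSingleₗᵢ 𝕜 n).continuous.tendsto _).comp (hl n)

lemma lp_parallelogram_le {κ : ℝ} {N : ℕ}
    (h : ∀ n, N ≤ n → ∀ x y : G n, ‖x + y‖ ^ 2 + ‖x - y‖ ^ 2 ≤ κ * (‖x‖ ^ 2 + ‖y‖ ^ 2))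
    {e f : lp G 2} (he : ∀ m, m < N → e m = 0) (hf : ∀ m, m < N → f m = 0) :
    ‖e + f‖ ^ 2 + ‖e - f‖ ^ 2 ≤ κ * (‖e‖ ^ 2 + ‖f‖ ^ 2) := by
  refine hasSum_le (fun m => ?_) (lp_hasSum_add_sub e f)
    (((lp_hasSum_norm_sq e).add (lp_hasSum_norm_sq f)).mul_left κ)
  rcases lt_or_ge m N with hm | hm
  · simp [he m hm, hf m hm]
  · exact h m hm _ _

lemma separableSpace_lp [∀ n, FiniteDimensional 𝕜 (G n)] :
    TopologicalSpace.SeparableSpace (lp G 2) := by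
  have hs : TopologicalSpace.IsSeparable (⋃ n, Set.range (lpSingleₗᵢ 𝕜 (G := G) n)) :=
    TopologicalSpace.IsSeparable.iUnion fun n => by
      have := FiniteDimensional.proper 𝕜 (G n)
      exact TopologicalSpace.isSeparable_range (lpSingleₗᵢ 𝕜 n).continuous
  have hs' := (hs.span (R := 𝕜)).closure
  refine TopologicalSpace.isSeparable_univ_iff.1 (hs'.mono fun f _ => ?_)
  refine mem_closure_of_tendsto (tendsto_sum_single f) (Eventually.of_forall fun N => ?_)
  refine Submodule.sum_mem _ fun n _ => Submodule.subset_span ?_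
  exact Set.mem_iUnion.2 ⟨n, f n, rfl⟩

lemma not_finiteDimensional_lp (h : {n | Nontrivial (G n)}.Infinite) :
    ¬ FiniteDimensional 𝕜 (lp G 2) := by
  classical
  intro hfd
  have hex : ∀ n : {n | Nontrivial (G n)}, ∃ x : G n, x ≠ 0 := fun n => by
    have : Nontrivial (G n) := n.2
    exact exists_ne 0
  choose x hx using hex
  have hli : LinearIndependent 𝕜 fun n : {n | Nontrivial (G n)} =>
      (lp.single 2 (n : ℕ) (x n) : lp G 2) := by
    rw [linearIndependent_iff']
    intro s c hc i hi
    have h1 : (∑ n ∈ s, c n • lp.single 2 (n : ℕ) (x n) : lp G 2) (i : ℕ) = 0 := by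
      rw [hc]; rfl
    rw [lp.coeFn_sum, Finset.sum_apply, Finset.sum_eq_single_of_mem i hi fun k _ hk => by
      rw [lp.coeFn_smul, Pi.smul_apply, lp.single_apply_ne _ _ _ fun h => hk (Subtype.ext h.symm),
        smul_zero], lp.coeFn_smul, Pi.smul_apply, lp.single_apply_self, smul_eq_zero] at h1
    exact h1.resolve_right (hx i)
  have := hli.finite_of_isNoetherian
  exact h (Set.toFinite _)

end Truncation

section AlmostParallelogram

variable {V : Type*} [NormedAddCommGroup V]

/-- Power mean inequality; the constant tends to the Hilbertian one as p → 2. -/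
lemma parallelogram_le_of_upper {p : ℝ} (hp0 : 0 < p) (hp2 : p ≤ 2)
    (h : ∀ x y : V, ‖x + y‖ ^ 2 + ‖x - y‖ ^ 2 ≤ 2 * (‖x‖ ^ p + ‖y‖ ^ p) ^ (2 / p)) (x y : V) :
    ‖x + y‖ ^ 2 + ‖x - y‖ ^ 2 ≤ 2 * 2 ^ (2 / p - 1) * (‖x‖ ^ 2 + ‖y‖ ^ 2) := by
  have hθ : 1 ≤ 2 / p := by rw [le_div_iff₀ hp0]; linarith
  have h1 : (‖x‖ ^ p + ‖y‖ ^ p) ^ (2 / p) ≤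
      2 ^ (2 / p - 1) * ((‖x‖ ^ p) ^ (2 / p) + (‖y‖ ^ p) ^ (2 / p)) := by
    have := NNReal.rpow_add_le_mul_rpow_add_rpow (‖x‖₊ ^ p) (‖y‖₊ ^ p) hθ
    exact_mod_cast this
  rw [rpow_rpow_two_div (norm_nonneg x) hp0, rpow_rpow_two_div (norm_nonneg y) hp0] at h1
  linarith [h x y]

/-- Applied to x + y and x - y, the lower bound becomes an upper one, and the power mean inequality
then bounds ‖x + y‖² + ‖x - y‖². -/
lemma parallelogram_le_of_lower {𝕜 : Type*} [RCLike 𝕜] [NormedSpace 𝕜 V] {q : ℝ} (hq2 : 2 ≤ q)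
    (h : ∀ x y : V, 2 * (‖x‖ ^ q + ‖y‖ ^ q) ^ (2 / q) ≤ ‖x + y‖ ^ 2 + ‖x - y‖ ^ 2) (x y : V) :
    ‖x + y‖ ^ 2 + ‖x - y‖ ^ 2 ≤ 2 * 2 ^ (1 - 2 / q) * (‖x‖ ^ 2 + ‖y‖ ^ 2) := by
  have hq0 : 0 < q := by linarith
  have hθ : 1 ≤ q / 2 := by linarith
  have hpow : ∀ a b : ℝ, 0 ≤ a → 0 ≤ b →
      a ^ 2 + b ^ 2 ≤ 2 ^ (1 - 2 / q) * (a ^ q + b ^ q) ^ (2 / q) := by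
    intro a b ha hb
    have h1 : (a ^ 2 + b ^ 2) ^ (q / 2) ≤ 2 ^ (q / 2 - 1) * ((a ^ 2) ^ (q / 2) + (b ^ 2) ^ (q / 2)) := by
      lift a to NNReal using ha
      lift b to NNReal using hb
      have := NNReal.rpow_add_le_mul_rpow_add_rpow (a ^ 2) (b ^ 2) hθ
      exact_mod_cast this
    have e : ∀ c : ℝ, 0 ≤ c → (c ^ 2) ^ (q / 2) = c ^ q := fun c hc => by
      rw [← Real.rpow_two, ← Real.rpow_mul hc, mul_div_cancel₀ _ two_ne_zero]
    rw [e a ha, e b hb] at h1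
    have h2 := Real.rpow_le_rpow (by positivity) h1 (by positivity : 0 ≤ 2 / q)
    rw [← Real.rpow_mul (by positivity), show q / 2 * (2 / q) = 1 by field_simp, Real.rpow_one,
      Real.mul_rpow (by positivity) (by positivity), ← Real.rpow_mul zero_le_two,
      show (q / 2 - 1) * (2 / q) = 1 - 2 / q by field_simp] at h2
    exact h2
  have h1 := hpow ‖x + y‖ ‖x - y‖ (norm_nonneg _) (norm_nonneg _)
  have h2 := h (x + y) (x - y)
  rw [show x + y + (x - y) = x + x by abel, show x + y - (x - y) = y + y by abel,
    norm_two_smul_sq (𝕜 := 𝕜), norm_two_smul_sq (𝕜 := 𝕜)] at h2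
  have h3 : (‖x + y‖ ^ q + ‖x - y‖ ^ q) ^ (2 / q) ≤ 2 * (‖x‖ ^ 2 + ‖y‖ ^ 2) := by linarith
  have h4 := mul_le_mul_of_nonneg_left h3 (by positivity : 0 ≤ (2 : ℝ) ^ (1 - 2 / q))
  linarith

end AlmostParallelogram

/-! ### Assembling the theorem. -/

section Final

variable {𝕜 : Type*} [RCLike 𝕜] {E F : ℕ → Type u}
  [∀ n, NormedAddCommGroup (E n)] [∀ n, NormedSpace 𝕜 (E n)]
  [∀ n, NormedAddCommGroup (F n)] [∀ n, NormedSpace 𝕜 (F n)]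

/-- Simultaneous truncation in both summands. -/
def twoSumTrunc (𝕜 : Type*) [RCLike 𝕜] (E F : ℕ → Type u)
    [∀ n, NormedAddCommGroup (E n)] [∀ n, NormedSpace 𝕜 (E n)]
    [∀ n, NormedAddCommGroup (F n)] [∀ n, NormedSpace 𝕜 (F n)] (N : ℕ) :
    TwoSum (lp E 2) (lp F 2) →ₗ[𝕜] TwoSum (lp E 2) (lp F 2) :=
  (WithLp.linearEquiv 2 𝕜 _).symm.toLinearMap ∘ₗ
    ((lpTrunc 𝕜 E N).prodMap (lpTrunc 𝕜 F N)) ∘ₗ (WithLp.linearEquiv 2 𝕜 _).toLinearMap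

lemma tendsto_toLp {X Y I : Type*} [NormedAddCommGroup X] [NormedAddCommGroup Y] {l : Filter I}
    {f : I → X} {g : I → Y} {x : X} {y : Y} (hf : Tendsto f l (𝓝 x)) (hg : Tendsto g l (𝓝 y)) :
    Tendsto (fun i => (WithLp.toLp 2 (f i, g i) : TwoSum X Y)) l (𝓝 (WithLp.toLp 2 (x, y))) :=
  ((WithLp.prod_continuous_toLp 2 X Y).tendsto (x, y)).comp (hf.prodMk_nhds hg)

/-- The 2-sum of two `ℓ₂`-sums of finite dimensional spaces, almost satisfying the parallelogram law
from some coordinate on, is asymptotically Hilbertian. -/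
theorem asymptoticallyHilbertian_twoSum [∀ n, FiniteDimensional 𝕜 (E n)]
    [∀ n, FiniteDimensional 𝕜 (F n)]
    (h : ∀ ε : ℝ, 0 < ε → ∃ N, ∀ n, N ≤ n →
      (∀ x y : E n, ‖x + y‖ ^ 2 + ‖x - y‖ ^ 2 ≤ 2 * (1 + ε) * (‖x‖ ^ 2 + ‖y‖ ^ 2)) ∧
      ∀ x y : F n, ‖x + y‖ ^ 2 + ‖x - y‖ ^ 2 ≤ 2 * (1 + ε) * (‖x‖ ^ 2 + ‖y‖ ^ 2)) :
    AsymptoticallyHilbertian (twoSumTrunc 𝕜 E F) where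
  exists_limit U x C hx := by
    obtain ⟨l, hl⟩ := exists_lp_limit (𝕜 := 𝕜) U (fun i => (x i).fst) C
      fun i => (WithLp.norm_fst_le _ (x i)).trans (hx i)
    obtain ⟨m, hm⟩ := exists_lp_limit (𝕜 := 𝕜) U (fun i => (x i).snd) C
      fun i => (WithLp.norm_snd_le _ (x i)).trans (hx i)
    exact ⟨WithLp.toLp 2 (l, m), fun N => tendsto_toLp (hl N) (hm N)⟩
  norm_sq N x := by
    rw [WithLp.prod_norm_sq_eq_of_L2, WithLp.prod_norm_sq_eq_of_L2 (twoSumTrunc 𝕜 E F N x),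
      WithLp.prod_norm_sq_eq_of_L2 (x - _)]
    have h1 := lp_norm_sq_trunc (𝕜 := 𝕜) N x.fst
    have h2 := lp_norm_sq_trunc (𝕜 := 𝕜) N x.snd
    change _ = ‖lpTrunc 𝕜 E N x.fst‖ ^ 2 + ‖lpTrunc 𝕜 F N x.snd‖ ^ 2 +
      (‖x.fst - lpTrunc 𝕜 E N x.fst‖ ^ 2 + ‖x.snd - lpTrunc 𝕜 F N x.snd‖ ^ 2)
    linarith
  tendsto x := tendsto_toLp (tendsto_lpTrunc x.fst) (tendsto_lpTrunc x.snd)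
  parallelogram_le ε hε := by
    obtain ⟨N, hN⟩ := h ε hε
    refine ⟨N, fun x y => ?_⟩
    simp only [WithLp.prod_norm_sq_eq_of_L2]
    have h1 := lp_parallelogram_le (fun n hn => (hN n hn).1)
      (fun m hm => sub_lpTrunc_apply (𝕜 := 𝕜) hm x.fst)
      (fun m hm => sub_lpTrunc_apply (𝕜 := 𝕜) hm y.fst)
    have h2 := lp_parallelogram_le (fun n hn => (hN n hn).2)
      (fun m hm => sub_lpTrunc_apply (𝕜 := 𝕜) hm x.snd)
      (fun m hm => sub_lpTrunc_apply (𝕜 := 𝕜) hm y.snd)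
    have h3 := add_le_add h1 h2
    rw [← mul_add] at h3
    refine le_trans (le_of_eq ?_) (h3.trans (le_of_eq ?_))
    · rw [add_add_add_comm]; rfl
    · rw [add_add_add_comm]; rfl

lemma eventually_two_rpow_le {f : ℕ → ℝ} (hf : Tendsto f atTop (𝓝 0)) {ε : ℝ} (hε : 0 < ε) :
    ∀ᶠ n in atTop, (2 : ℝ) ^ f n ≤ 1 + ε := by
  have h : Tendsto (fun n => (2 : ℝ) ^ f n) atTop (𝓝 (2 ^ (0 : ℝ))) :=
    tendsto_const_nhds.rpow hf (Or.inl two_ne_zero)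
  rw [Real.rpow_zero] at h
  exact (h.eventually_lt_const (by linarith)).mono fun n hn => hn.le

end Final

theorem corollary5p7 {𝕜 : Type*} [RCLike 𝕜] (E F : ℕ → Type u)
    [∀ n, NormedAddCommGroup (E n)] [∀ n, NormedSpace 𝕜 (E n)] [∀ n, FiniteDimensional 𝕜 (E n)]
    [∀ n, NormedAddCommGroup (F n)] [∀ n, NormedSpace 𝕜 (F n)] [∀ n, FiniteDimensional 𝕜 (F n)]
    (p q : ℕ → ℝ)
    (hp1 : ∀ n, 1 ≤ p n) (hp2 : ∀ n, p n < 2) (hp : Tendsto p atTop (𝓝 2))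
    (hq2 : ∀ n, 2 < q n) (hq : Tendsto q atTop (𝓝 2))
    (hEa : ∀ n, ∀ x y : E n,
      ‖x + y‖ ^ 2 + ‖x - y‖ ^ 2 ≤ 2 * (‖x‖ ^ p n + ‖y‖ ^ p n) ^ (2 / p n))
    (hEb : ∀ n, HasLpPairBasis 𝕜 (E n) (p n))
    (hFa : ∀ n, ∀ x y : F n,
      2 * (‖x‖ ^ q n + ‖y‖ ^ q n) ^ (2 / q n) ≤ ‖x + y‖ ^ 2 + ‖x - y‖ ^ 2)
    (hFb : ∀ n, HasLpPairBasis 𝕜 (F n) (q n))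
    (C : ℝ)
    (hFsmooth : ∀ n, ∀ x y : F n,
      ‖x + y‖ ^ 2 + ‖x - y‖ ^ 2 ≤ 2 * (‖x‖ ^ 2 + (C * ‖y‖) ^ 2)) :
    (∀ (H : Type v) [NormedAddCommGroup H] [InnerProductSpace 𝕜 H] [CompleteSpace H]
      (T : TwoSum (TwoSumSeq E) (TwoSumSeq F) →ₗᵢ[𝕜]
        TwoSum (TwoSum (TwoSumSeq E) (TwoSumSeq F)) H),
      Set.range (fun e : TwoSumSeq E => T (WithLp.toLp 2 (e, 0))) =
        Set.range (fun e : TwoSumSeq E => WithLp.toLp 2 (WithLp.toLp 2 (e, 0), 0)) ∧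
      Set.range (fun f : TwoSumSeq F => T (WithLp.toLp 2 (0, f))) =
        Set.range (fun f : TwoSumSeq F => WithLp.toLp 2 (WithLp.toLp 2 (0, f), 0))) ∧
    ({n | Nontrivial (E n) ∨ Nontrivial (F n)}.Infinite →
      CategoricityCriterion 𝕜 (TwoSum (TwoSumSeq E) (TwoSumSeq F)) ∧
      IsUncountablyCategorical 𝕜 (TwoSum (TwoSumSeq E) (TwoSumSeq F))) := by
  have hEc : ∀ n, CompleteSpace (E n) := fun n => FiniteDimensional.complete 𝕜 (E n)
  have hFc : ∀ n, CompleteSpace (F n) := fun n => FiniteDimensional.complete 𝕜 (F n)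
  refine ⟨fun H _ _ _ T => ?_, fun hinf => ?_⟩
  · have h := range_fst_eq hp1 hp2 hp hEa hEb hFsmooth T
    exact ⟨h, range_snd_eq hq2 hq hFa hFb T h⟩
  have hE0 : Tendsto (fun n => 2 / p n - 1) atTop (𝓝 0) := by
    have := (Tendsto.div (tendsto_const_nhds (x := (2 : ℝ))) hp two_ne_zero).sub_const 1
    simpa using this
  have hF0 : Tendsto (fun n => 1 - 2 / q n) atTop (𝓝 0) := by
    have := (Tendsto.div (tendsto_const_nhds (x := (2 : ℝ))) hq two_ne_zero).const_sub 1
    simpa using this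
  have hAH : AsymptoticallyHilbertian (twoSumTrunc 𝕜 E F) :=
    asymptoticallyHilbertian_twoSum fun ε hε => by
      obtain ⟨N, hN⟩ := eventually_atTop.1
        ((eventually_two_rpow_le hE0 hε).and (eventually_two_rpow_le hF0 hε))
      refine ⟨N, fun n hn => ⟨fun x y => ?_, fun x y => ?_⟩⟩
      · refine (parallelogram_le_of_upper (by linarith [hp1 n]) (hp2 n).le (hEa n) x y).trans ?_
        have := (hN n hn).1
        gcongr
      · refine (parallelogram_le_of_lower (𝕜 := 𝕜) (hq2 n).le (hFa n) x y).trans ?_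
        have := (hN n hn).2
        gcongr
  have hsep : TopologicalSpace.SeparableSpace (TwoSum (TwoSumSeq E) (TwoSumSeq F)) := by
    have h1 : TopologicalSpace.SeparableSpace (TwoSumSeq E) := separableSpace_lp (𝕜 := 𝕜)
    have h2 : TopologicalSpace.SeparableSpace (TwoSumSeq F) := separableSpace_lp (𝕜 := 𝕜)
    exact (WithLp.toLp_surjective 2).denseRange.separableSpace (WithLp.prod_continuous_toLp 2 _ _)
  have hcrit : CategoricityCriterion 𝕜 (TwoSum (TwoSumSeq E) (TwoSumSeq F)) := by
    refine ⟨inferInstance, fun hfd => ?_, fun I U => hAH.exists_hilbert U, fun H _ _ _ T => ?_⟩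
    · rcases (Set.infinite_union (s := {n | Nontrivial (E n)}) (t := {n | Nontrivial (F n)})).1 hinf
        with h | h
      · exact not_finiteDimensional_lp h (FiniteDimensional.of_injective
          (twoSumInl 𝕜 (lp E 2) (lp F 2)).toLinearMap (LinearIsometry.injective _))
      · exact not_finiteDimensional_lp h (FiniteDimensional.of_injective
          (twoSumInr 𝕜 (lp E 2) (lp F 2)).toLinearMap (LinearIsometry.injective _))
    · have hE := range_fst_eq hp1 hp2 hp hEa hEb hFsmooth T
      have hF := range_snd_eq hq2 hq hFa hFb T hE
      -- Both ranges are sums of their parts over E and F, so the equalities on the summands add up.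
      have hsplit : ∀ x : TwoSum (lp E 2) (lp F 2),
          x = twoSumInl 𝕜 (lp E 2) (lp F 2) x.fst + twoSumInr 𝕜 (lp E 2) (lp F 2) x.snd :=
        fun x => by
          change x = WithLp.toLp 2 (x.fst, (0 : lp F 2)) + WithLp.toLp 2 ((0 : lp E 2), x.snd)
          rw [← WithLp.toLp_add, Prod.mk_add_mk, zero_add, add_zero]
          rfl
      let J := twoSumInl 𝕜 (TwoSum (lp E 2) (lp F 2)) H
      change Set.range T = Set.range J
      refine Set.Subset.antisymm ?_ ?_
      · rintro _ ⟨x, rfl⟩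
        obtain ⟨e, he⟩ := hE.subset ⟨x.fst, rfl⟩
        obtain ⟨f, hf⟩ := hF.subset ⟨x.snd, rfl⟩
        refine ⟨twoSumInl 𝕜 _ _ e + twoSumInr 𝕜 _ _ f, ?_⟩
        rw [map_add, hsplit x, map_add]
        exact congrArg₂ (· + ·) he hf
      · rintro _ ⟨x, rfl⟩
        obtain ⟨e, he⟩ := hE.superset ⟨x.fst, rfl⟩
        obtain ⟨f, hf⟩ := hF.superset ⟨x.snd, rfl⟩
        refine ⟨twoSumInl 𝕜 _ _ e + twoSumInr 𝕜 _ _ f, ?_⟩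
        rw [map_add, hsplit x, map_add]
        exact congrArg₂ (· + ·) he hf
  exact ⟨hcrit, hcrit.isUncountablyCategorical⟩

end
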